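/- Let $G$ be a finite-dimensional real Lie group with Lie algebra $\mathfrak g$ and dual $\mathfrak g^*$. Write $R_g(x)=xg$, $\mathrm{ad}_\sigma v=[\sigma,v]$, let $\mathrm{Ad}_g^*$ be the dual of $\mathrm{Ad}_g$, and put $\operatorname{dexp}_\sigma=\sum_{k\ge 0}\frac{1}{(k+1)!}\mathrm{ad}_\sigma^k$; a star on a linear map of $\mathfrak g$ denotes the dual map on $\mathfrak g^*$. Let $\mathbf G=G\ltimes\mathfrak g^*$ be $G\times\mathfrak g^*$ with the product $(g_1,\mu_1)\cdot(g_2,\mu_2)=(g_1g_2,\ \mu_1+\mathrm{Ad}^*_{g_1^{-1}}\mu_2)$ (the right-trivialised cotangent bundle of $G$), and let $$\omega_{(g,\mu)}\bigl((R_{g*}\xi_1,\delta\nu_1),(R_{g*}\xi_2,\delta\nu_2)\bigr)=\langle\delta\nu_2,\xi_1\rangle-\langle\delta\nu_1,\xi_2\rangle-\langle\mu,[\xi_1,\xi_2]\rangle$$ be the trivialised canonical symplectic form. Let $H:\mathbf G\to\mathbb R$ be smooth and let $f:\mathbf G\to T_e\mathbf G=\mathfrak g\times\mathfrak g^*$ represent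 its Hamiltonian vector field, i.e. $F(x)=T_eR_x f(x)$ satisfies $\omega(F,X)=dH(X)$ for all tangent vectors $X$, where $R_x$ is right multiplication by $x$ in $\mathbf G$. Let $a_{ij},b_i$ ($1\le i,j\le s$) be real numbers with $\sum_i b_i=1$ and $b_i\ne 0$ for all $i$, and let $h\in\mathbb R$. For $(g_0,\mu_0)\in\mathbf G$ consider the scheme \begin{align*} (\xi_i,\bar n_i)&=h f(G_i,M_i),\qquad n_i=\mathrm{Ad}^*_{\exp(X_i)}\bar n_i,\qquad i=1,\dots,s,\\ Y&=\sum_i b_i\xi_i,\qquad X_i=\sum_j a_{ij}\xi_j,\qquad G_i=\exp(X_i)\cdot g_0,\\ M_i&=\operatorname{dexp}_{-Y}^*\mu_0+\sum_j\Bigl(b_j\operatorname{dexp}_{-Y}^*-\frac{b_ja_{ji}}{b_i}\operatorname{dexp}_{-X_j}^*\Bigr)n_j,\\ (g_1,\mu_1)&=\exp\Bigl(Y,(\operatorname{dexp}_Y^{-1})^*\sum_i b_in_i\Bigr)\cdot(g_0,\mu_0), \end{align*} where the last $\exp$ and product are those of the group $\mathbf G$. The scheme is symplectic: if $U\subseteq\mathbf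 G$ is open and $(\xi_i,\bar n_i)_{i=1}^s$ are $C^1$ functions of $(g_0,\mu_0)\in U$ which solve the stage equations at every point of $U$, with $\operatorname{dexp}_Y$ invertible there, then the resulting map $\Phi:(g_0,\mu_0)\mapsto(g_1,\mu_1)$ is $C^1$ on $U$ and $\Phi^*\omega=\omega$ on $U$. -/

import Mathlib

open scoped Manifold ContDiff

noncomputable section

namespace SLGI

section Exponential

/-- `γ` is the one-parameter subgroup of `G` with initial velocity `ξ ∈ T_1 G` (the tangent spaces
of a manifold modelled on `E` are by definition copies of `E`). -/
def IsOneParameterSubgroup {E H : Type*} [NormedAddCommGroup E] [NormedSpace ℝ E]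
    [TopologicalSpace H] (I : ModelWithCorners ℝ E H) {G : Type*} [TopologicalSpace G]
    [ChartedSpace H G] [Group G] (γ : ℝ → G) (ξ : E) : Prop :=
  (∀ s t : ℝ, γ (s + t) = γ s * γ t) ∧ ContMDiff 𝓘(ℝ, ℝ) I ∞ γ ∧
    (mfderiv 𝓘(ℝ, ℝ) I γ 0 (1 : ℝ) : E) = ξ

open Classical in
/-- The exponential map of a Lie group: `exp ξ = γ 1`, where `γ` is the one-parameter subgroup with
initial velocity `ξ`. -/
def lieExp {E H : Type*} [NormedAddCommGroup E] [NormedSpace ℝ E]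
    [TopologicalSpace H] (I : ModelWithCorners ℝ E H) (G : Type*) [TopologicalSpace G]
    [ChartedSpace H G] [Group G] (ξ : E) : G :=
  if h : ∃ γ : ℝ → G, IsOneParameterSubgroup I γ ξ then h.choose 1 else 1

end Exponential

section LieGroup

/-! `G` is a real Lie group modelled on the finite-dimensional space `E`. Its Lie algebra
`𝔤 = T_1 G` is `GroupLieAlgebra 𝓘(ℝ, E) G`, which is by definition the vector space `E` carrying
the bracket of left-invariant vector fields; below it is written `E` (so as to carry the norm of
`E`), and its dual `𝔤*` is written `E →L[ℝ] ℝ`. -/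

variable {E : Type*} [NormedAddCommGroup E] [NormedSpace ℝ E]
variable {G : Type*} [TopologicalSpace G] [ChartedSpace E G] [Group G]

/-- `Ad_g`, the derivative at `1` of `x ↦ g x g⁻¹`. -/
def Ad (g : G) : E →L[ℝ] E := mfderiv 𝓘(ℝ, E) 𝓘(ℝ, E) (fun x : G => g * x * g⁻¹) 1

/-- The coadjoint action `⟨Ad_g^* μ, ξ⟩ = ⟨μ, Ad_g ξ⟩`. -/
def coAd (g : G) (μ : E →L[ℝ] ℝ) : E →L[ℝ] ℝ := μ.comp (Ad g)

/-- Right trivialisation: `rightTriv g v` is the `ξ ∈ 𝔤` with `R_{g*} ξ = v`, for `v ∈ T_g G`. -/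
def rightTriv (g : G) : TangentSpace 𝓘(ℝ, E) g →L[ℝ] E :=
  mfderiv 𝓘(ℝ, E) 𝓘(ℝ, E) (fun x : G => x * g⁻¹) g


/-- `R_{g*} : 𝔤 → T_g G`, the derivative at `1` of `x ↦ x g`. -/
def rightTranslate (g : G) : E →L[ℝ] TangentSpace 𝓘(ℝ, E) (1 * g) :=
  mfderiv 𝓘(ℝ, E) 𝓘(ℝ, E) (fun x : G => x * g) 1

theorem Ad_one : Ad (E := E) (1 : G) = ContinuousLinearMap.id ℝ E := by
  have h : (fun x : G => 1 * x * (1 : G)⁻¹) = id := by funext x; simp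
  unfold Ad
  rw [h]
  exact mfderiv_id

variable [LieGroup 𝓘(ℝ, E) ∞ G]

theorem rightTriv_rightTranslate (g : G) (ξ : E) :
    rightTriv (1 * g) (rightTranslate g ξ) = ξ := by
  have h1 : MDifferentiable 𝓘(ℝ, E) 𝓘(ℝ, E) (fun x : G => x * g) :=
    (contMDiff_mul_right (I := 𝓘(ℝ, E)) (n := ∞) (a := g)).mdifferentiable (by simp)
  have h2 : MDifferentiable 𝓘(ℝ, E) 𝓘(ℝ, E) (fun x : G => x * (1 * g)⁻¹) :=
    (contMDiff_mul_right (I := 𝓘(ℝ, E)) (n := ∞) (a := (1 * g)⁻¹)).mdifferentiable (by simp)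
  have h := mfderiv_comp (1 : G) (h2 (1 * g)) (h1 1)
  have h3 : (fun x : G => x * (1 * g)⁻¹) ∘ (fun x : G => x * g) = id := by
    funext x; simp
  rw [h3, mfderiv_id] at h
  exact (DFunLike.congr_fun h ξ).symm

theorem Ad_mul (g k : G) : Ad (E := E) (g * k) = (Ad g).comp (Ad k) := by
  have hc : ∀ a : G, MDifferentiable 𝓘(ℝ, E) 𝓘(ℝ, E) (fun x : G => a * x * a⁻¹) := fun a =>
    ((contMDiff_mul_right (I := 𝓘(ℝ, E)) (n := ∞) (a := a⁻¹)).comp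
      (contMDiff_mul_left (I := 𝓘(ℝ, E)) (n := ∞) (a := a))).mdifferentiable (by simp)
  have h := mfderiv_comp (1 : G) (hc g (k * 1 * k⁻¹)) (hc k 1)
  have h3 : (fun x : G => g * x * g⁻¹) ∘ (fun x : G => k * x * k⁻¹) =
      fun x : G => (g * k) * x * (g * k)⁻¹ := by
    funext x; simp [mul_assoc]
  rw [h3] at h
  have h4 : k * 1 * k⁻¹ = 1 := by simp
  unfold Ad
  rw [h]
  rw [h4]
  rfl

variable (G)

instance instLieGroupMinSmoothness : LieGroup 𝓘(ℝ, E) (minSmoothness ℝ 3) G :=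
  LieGroup.of_le (n := ∞) (by
    rw [minSmoothness_of_isRCLikeNormedField]
    exact WithTop.coe_le_coe.2 (le_top : (3 : ℕ∞) ≤ ⊤))

/-- The Lie bracket of `𝔤`. -/
def bracket (ξ η : E) : E :=
  @Bracket.bracket (GroupLieAlgebra 𝓘(ℝ, E) G) (GroupLieAlgebra 𝓘(ℝ, E) G) _ ξ η

variable [FiniteDimensional ℝ E]

/-- `ad_σ v = [σ, v]`. -/
def ad (σ : E) : E →L[ℝ] E :=
  LinearMap.toContinuousLinearMap
    (show E →ₗ[ℝ] E from LieAlgebra.ad ℝ (GroupLieAlgebra 𝓘(ℝ, E) G) σ)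

theorem ad_apply (σ v : E) : ad G σ v = bracket G σ v := rfl

/-- `dexp_σ = ∑ₖ ad_σ ^ k / (k + 1)!`. -/
def dexp (σ : E) : E →L[ℝ] E :=
  ∑' k : ℕ, ((Nat.factorial (k + 1) : ℝ)⁻¹) • (ad G σ) ^ k

/-- The dual map `dexp_σ^* : 𝔤* → 𝔤*`. -/
def dexpDual (σ : E) (μ : E →L[ℝ] ℝ) : E →L[ℝ] ℝ := μ.comp (dexp G σ)

/-- The dual map `(dexp_σ⁻¹)^* : 𝔤* → 𝔤*` (meaningful when `dexp_σ` is invertible). -/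
def dexpInvDual (σ : E) (μ : E →L[ℝ] ℝ) : E →L[ℝ] ℝ := μ.comp (dexp G σ).inverse

end LieGroup

section Cotangent

/-- The set underlying the semidirect product `𝐆 = G ⋉ 𝔤*`, i.e. the right-trivialised cotangent
bundle `G × 𝔤*`. It carries the product topology and product manifold structure. -/
def Cotangent (E : Type*) [NormedAddCommGroup E] [NormedSpace ℝ E] (G : Type*) : Type _ :=
  G × (E →L[ℝ] ℝ)

/-- The model of the manifold `G × 𝔤*`. -/
abbrev cotModel (E : Type*) [NormedAddCommGroup E] [NormedSpace ℝ E] :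
    ModelWithCorners ℝ (E × (E →L[ℝ] ℝ)) (ModelProd E (E →L[ℝ] ℝ)) :=
  𝓘(ℝ, E).prod 𝓘(ℝ, E →L[ℝ] ℝ)

variable {E : Type*} [NormedAddCommGroup E] [NormedSpace ℝ E]
variable {G : Type*}

namespace Cotangent

def mk (g : G) (μ : E →L[ℝ] ℝ) : Cotangent E G := (g, μ)

def base (x : Cotangent E G) : G := x.1

def momentum (x : Cotangent E G) : E →L[ℝ] ℝ := x.2

end Cotangent

variable [TopologicalSpace G] [ChartedSpace E G]

instance : TopologicalSpace (Cotangent E G) :=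
  inferInstanceAs (TopologicalSpace (G × (E →L[ℝ] ℝ)))

instance : ChartedSpace (ModelProd E (E →L[ℝ] ℝ)) (Cotangent E G) :=
  inferInstanceAs (ChartedSpace (ModelProd E (E →L[ℝ] ℝ)) (G × (E →L[ℝ] ℝ)))

variable [Group G]

/-- `(g₁, μ₁) (g₂, μ₂) = (g₁ g₂, μ₁ + Ad_{g₁⁻¹}^* μ₂)`. -/
instance : Mul (Cotangent E G) :=
  ⟨fun x y => Cotangent.mk (x.base * y.base) (x.momentum + coAd x.base⁻¹ y.momentum)⟩

instance : One (Cotangent E G) := ⟨Cotangent.mk 1 0⟩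

instance : Inv (Cotangent E G) :=
  ⟨fun x => Cotangent.mk x.base⁻¹ (-coAd x.base x.momentum)⟩

/-- The group `𝐆 = G ⋉ 𝔤*`. -/
instance [LieGroup 𝓘(ℝ, E) ∞ G] : Group (Cotangent E G) :=
  Group.ofLeftAxioms
    (by
      rintro ⟨g, μ⟩ ⟨k, ν⟩ ⟨l, ρ⟩
      refine Prod.ext (mul_assoc g k l) ?_
      change μ + coAd g⁻¹ ν + coAd (g * k)⁻¹ ρ = μ + coAd g⁻¹ (ν + coAd k⁻¹ ρ)
      simp only [coAd, mul_inv_rev, Ad_mul, ContinuousLinearMap.add_comp, add_assoc,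
        ContinuousLinearMap.comp_assoc])
    (by
      rintro ⟨g, μ⟩
      refine Prod.ext (one_mul g) ?_
      change 0 + coAd (1 : G)⁻¹ μ = μ
      simp [coAd, Ad_one])
    (by
      rintro ⟨g, μ⟩
      refine Prod.ext (inv_mul_cancel g) ?_
      change -coAd g μ + coAd (g⁻¹)⁻¹ μ = 0
      simp)

variable [LieGroup 𝓘(ℝ, E) ∞ G] [FiniteDimensional ℝ E]

/-- The trivialised canonical symplectic form
`ω_{(g,μ)} ((R_{g*} ξ₁, δν₁), (R_{g*} ξ₂, δν₂)) = ⟨δν₂, ξ₁⟩ - ⟨δν₁, ξ₂⟩ - ⟨μ, [ξ₁, ξ₂]⟩`. -/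
def sympForm (x : Cotangent E G) (V W : TangentSpace (cotModel E) x) : ℝ :=
  let ξ₁ : E := rightTriv x.base (show E × (E →L[ℝ] ℝ) from V).1
  let δν₁ : E →L[ℝ] ℝ := (show E × (E →L[ℝ] ℝ) from V).2
  let ξ₂ : E := rightTriv x.base (show E × (E →L[ℝ] ℝ) from W).1
  let δν₂ : E →L[ℝ] ℝ := (show E × (E →L[ℝ] ℝ) from W).2
  δν₂ ξ₁ - δν₁ ξ₂ - x.momentum (bracket G ξ₁ ξ₂)

/-- `T_e R_x : T_e 𝐆 = 𝔤 × 𝔤* → T_x 𝐆`, the derivative at the identity of right multiplication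
by `x` in `𝐆`. -/
def rightMap (x : Cotangent E G) : E × (E →L[ℝ] ℝ) →L[ℝ] TangentSpace (cotModel E) x :=
  mfderiv (cotModel E) (cotModel E) (fun y : Cotangent E G => y * x) 1

/-- `F` is the Hamiltonian vector field of `H`: `i_F ω = dH`, where `i_F ω (X) = ω(F, X)`. -/
def IsHamiltonianField (H : Cotangent E G → ℝ)
    (F : (x : Cotangent E G) → TangentSpace (cotModel E) x) : Prop :=
  ∀ (x : Cotangent E G) (X : TangentSpace (cotModel E) x),
    sympForm x (F x) X = (mfderiv (cotModel E) 𝓘(ℝ, ℝ) H x X : ℝ)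

/-- A map is symplectic on the (open) set `U`: it is `C¹` there and preserves `ω`. -/
def IsSymplecticOn (Φ : Cotangent E G → Cotangent E G) (U : Set (Cotangent E G)) : Prop :=
  ContMDiffOn (cotModel E) (cotModel E) 1 Φ U ∧
    ∀ x ∈ U, ∀ V W : TangentSpace (cotModel E) x,
      sympForm (Φ x) (mfderiv (cotModel E) (cotModel E) Φ x V)
        (mfderiv (cotModel E) (cotModel E) Φ x W) = sympForm x V W

end Cotangent

section Scheme

/-! In the scheme the unknowns are the stage values `k i = (ξ_i, n̄_i) ∈ 𝔤 × 𝔤*`. -/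

variable {E : Type*} [NormedAddCommGroup E] [NormedSpace ℝ E] {s : ℕ}

/-- `Y = ∑ᵢ bᵢ ξᵢ`. -/
def stageY (b : Fin s → ℝ) (k : Fin s → E × (E →L[ℝ] ℝ)) : E := ∑ i, b i • (k i).1

/-- `X_i = ∑ⱼ aᵢⱼ ξⱼ`. -/
def stageX (a : Fin s → Fin s → ℝ) (k : Fin s → E × (E →L[ℝ] ℝ)) (i : Fin s) : E :=
  ∑ j, a i j • (k j).1

variable {G : Type*} [TopologicalSpace G] [ChartedSpace E G] [Group G]

variable (G) in
/-- `n_i = Ad_{exp X_i}^* n̄_i`. -/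
def stageN (a : Fin s → Fin s → ℝ) (k : Fin s → E × (E →L[ℝ] ℝ)) (i : Fin s) : E →L[ℝ] ℝ :=
  coAd (lieExp 𝓘(ℝ, E) G (stageX a k i)) (k i).2

/-- `G_i = exp X_i · g₀`. -/
def stageG (a : Fin s → Fin s → ℝ) (x₀ : Cotangent E G) (k : Fin s → E × (E →L[ℝ] ℝ))
    (i : Fin s) : G :=
  lieExp 𝓘(ℝ, E) G (stageX a k i) * x₀.base

variable [LieGroup 𝓘(ℝ, E) ∞ G] [FiniteDimensional ℝ E]

/-- `M_i = dexp_{-Y}^* μ₀ + ∑ⱼ (bⱼ dexp_{-Y}^* - (bⱼ aⱼᵢ / bᵢ) dexp_{-X_j}^*) n_j`. -/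
def stageM (a : Fin s → Fin s → ℝ) (b : Fin s → ℝ) (x₀ : Cotangent E G)
    (k : Fin s → E × (E →L[ℝ] ℝ)) (i : Fin s) : E →L[ℝ] ℝ :=
  dexpDual G (-stageY b k) x₀.momentum +
    ∑ j, (b j • dexpDual G (-stageY b k) (stageN G a k j) -
      (b j * a j i / b i) • dexpDual G (-stageX a k j) (stageN G a k j))

/-- The stage equations `(ξ_i, n̄_i) = h f(G_i, M_i)` at the point `x₀ = (g₀, μ₀)`, together with
the invertibility of `dexp_Y` that makes the update meaningful. -/
def IsStageSolution (a : Fin s → Fin s → ℝ) (b : Fin s → ℝ)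
    (f : Cotangent E G → E × (E →L[ℝ] ℝ)) (h : ℝ) (x₀ : Cotangent E G)
    (k : Fin s → E × (E →L[ℝ] ℝ)) : Prop :=
  (dexp G (stageY b k)).IsInvertible ∧
    ∀ i, k i = h • f (Cotangent.mk (stageG a x₀ k i) (stageM a b x₀ k i))

/-- The update `(g₁, μ₁) = exp (Y, (dexp_Y⁻¹)^* ∑ᵢ bᵢ nᵢ) · (g₀, μ₀)`, with the exponential map and
the product of `𝐆`. -/
def update (a : Fin s → Fin s → ℝ) (b : Fin s → ℝ) (x₀ : Cotangent E G)
    (k : Fin s → E × (E →L[ℝ] ℝ)) : Cotangent E G :=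
  lieExp (cotModel E) (Cotangent E G)
    ((stageY b k, dexpInvDual G (stageY b k) (∑ i, b i • stageN G a k i)) :
      E × (E →L[ℝ] ℝ)) * x₀

end Scheme

end SLGI

end

/-!
The scheme is a variational integrator, and its symplecticity is the identity `d² = 0`.

In the right trivialisation the canonical one-form is `θ = ⟨μ, dg g⁻¹⟩`, and `ω = -dθ` by the
Maurer–Cartan equation. Along a family of stage solutions consider the discrete action
`S = ∑ᵢ bᵢ (⟨M_i, ξ_i⟩ - h H (G_i, M_i))`. Since `(ξ_i, n̄_i) = h f (G_i, M_i)` and `f` represents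
the Hamiltonian vector field, the variations of `M_i` drop out of `dS`, which becomes
`∑ᵢ bᵢ (⟨M_i, dξ_i⟩ + ⟨n̄_i, dG_i G_i⁻¹⟩)`. The logarithmic derivative of `G_i = exp X_i · g₀` is
`dexp_{X_i} dX_i + Ad_{exp X_i} (dg₀ g₀⁻¹)`, and the coefficients in `M_i` are chosen such that,
after interchanging the order of summation (`stage_sum_eq`), all the terms with `dexp_{X_i}`
cancel. What remains is `dS = ⟨μ₁, dg₁ g₁⁻¹⟩ - ⟨μ₀, dg₀ g₀⁻¹⟩` (`hasFDerivAt_discreteAction`),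
because the update is `(exp Y · g₀, Ad_{exp (-Y)}^* (μ₀ + ∑ᵢ bᵢ n_i))` (`update_eq`). Taking the exterior
derivative gives `Φ^* ω = ω`.

The stage values are only `C¹`, so the one-forms above are only continuous and the equation
`d (dS) = 0` needs an argument: `antisymm_eq_of_exact` subtracts from each one-form an exact form
such that the difference is differentiable at the given point.

The calculus on `G` rests on `HasLogDerivAt`, the right logarithmic derivative, defined by the chart
at the identity only. The theory of the exponential map is developed in these terms:
one-parameter subgroups exist, `Ad_{exp ξ} = exp (ad_ξ)` (`Ad_lieExp`), the logarithmic derivative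
of `exp` is `dexp` (`hasLogDerivAt_lieExp`), and the exponential map of `G ⋉ 𝔤*` is computed in
`lieExp_cotangent`.
-/

noncomputable section

namespace SLGI

open Filter Topology Function

/-! ### The multiplication in the chart at the identity -/

section UnitChart

variable (E : Type*) [NormedAddCommGroup E] [NormedSpace ℝ E]
variable (G : Type*) [TopologicalSpace G] [ChartedSpace E G] [Group G]

/-- The preferred chart of `G` at the identity, with values in `E`. -/
def unitChart : PartialEquiv G E := extChartAt 𝓘(ℝ, E) (1 : G)

/-- The coordinates of the identity of `G`. -/
abbrev unitCoord : E := unitChart E G 1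

/-- The multiplication of `G` in the chart at the identity. -/
def chartMul (p : E × E) : E :=
  unitChart E G ((unitChart E G).symm p.1 * (unitChart E G).symm p.2)

/-- Conjugation `(g, x) ↦ g x g⁻¹` in the chart at the identity. -/
def chartConj (p : E × E) : E :=
  unitChart E G ((unitChart E G).symm p.1 * (unitChart E G).symm p.2 * ((unitChart E G).symm p.1)⁻¹)

/-- `chartRight E G b ξ` represents, in the chart at the identity, the value at the point with
coordinates `b` of the right-invariant vector field with value `ξ` at the identity. -/
def chartRight (b : E) : E →L[ℝ] E :=
  fderiv ℝ (fun a => chartMul E G (a, b)) (unitCoord E G)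

/-- `chartLeft E G a ξ` represents, in the chart at the identity, the value at the point with
coordinates `a` of the left-invariant vector field with value `ξ` at the identity. -/
def chartLeft (a : E) : E →L[ℝ] E :=
  fderiv ℝ (fun b => chartMul E G (a, b)) (unitCoord E G)

variable {E G}

theorem eventually_unitChart_right_inv :
    ∀ᶠ a in 𝓝 (unitCoord E G), unitChart E G ((unitChart E G).symm a) = a := by
  filter_upwards [extChartAt_target_mem_nhds (I := 𝓘(ℝ, E)) (1 : G)] with a ha
  exact (unitChart E G).right_inv ha

theorem eventually_unitChart_left_inv :
    ∀ᶠ g in 𝓝 (1 : G), (unitChart E G).symm (unitChart E G g) = g := by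
  filter_upwards [extChartAt_source_mem_nhds (I := 𝓘(ℝ, E)) (1 : G)] with g hg
  exact (unitChart E G).left_inv hg

@[simp]
theorem unitChart_symm_unitCoord : (unitChart E G).symm (unitCoord E G) = 1 :=
  extChartAt_to_inv (I := 𝓘(ℝ, E)) (1 : G)

theorem continuousAt_unitChart : ContinuousAt (unitChart E G) 1 :=
  continuousAt_extChartAt (I := 𝓘(ℝ, E)) (1 : G)

theorem continuousAt_unitChart_symm : ContinuousAt (unitChart E G).symm (unitCoord E G) :=
  continuousAt_extChartAt_symm (I := 𝓘(ℝ, E)) (1 : G)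

theorem tendsto_unitChart_symm :
    Tendsto (unitChart E G).symm (𝓝 (unitCoord E G)) (𝓝 1) := by
  have h := continuousAt_unitChart_symm (E := E) (G := G)
  rwa [ContinuousAt, unitChart_symm_unitCoord] at h

theorem contMDiffAt_unitChart : ContMDiffAt 𝓘(ℝ, E) 𝓘(ℝ, E) ∞ (unitChart E G) 1 :=
  contMDiffAt_extChartAt

variable (E G) in
theorem isTopologicalGroup (_ : LieGroup 𝓘(ℝ, E) ∞ G) : IsTopologicalGroup G :=
  topologicalGroup_of_lieGroup 𝓘(ℝ, E) ∞

theorem chartMul_unitCoord_right :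
    (fun a => chartMul E G (a, unitCoord E G)) =ᶠ[𝓝 (unitCoord E G)] id := by
  filter_upwards [eventually_unitChart_right_inv (E := E) (G := G)] with a ha
  simpa [chartMul] using ha

theorem chartMul_unitCoord_left :
    (fun b => chartMul E G (unitCoord E G, b)) =ᶠ[𝓝 (unitCoord E G)] id := by
  filter_upwards [eventually_unitChart_right_inv (E := E) (G := G)] with a ha
  simpa [chartMul] using ha

theorem chartRight_unitCoord : chartRight E G (unitCoord E G) = ContinuousLinearMap.id ℝ E := by
  rw [chartRight, chartMul_unitCoord_right.fderiv_eq, fderiv_id]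

theorem chartLeft_unitCoord : chartLeft E G (unitCoord E G) = ContinuousLinearMap.id ℝ E := by
  rw [chartLeft, chartMul_unitCoord_left.fderiv_eq, fderiv_id]

variable [LieGroup 𝓘(ℝ, E) ∞ G]

theorem contMDiffAt_unitChart_symm :
    ContMDiffAt 𝓘(ℝ, E) 𝓘(ℝ, E) ∞ (unitChart E G).symm (unitCoord E G) :=
  haveI : IsManifold 𝓘(ℝ, E) ∞ G := ContMDiffMul.toIsManifold
  (contMDiffOn_extChartAt_symm (I := 𝓘(ℝ, E)) (n := ∞) (1 : G)).contMDiffAt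
    (extChartAt_target_mem_nhds (I := 𝓘(ℝ, E)) (1 : G))

theorem contDiffAt_chartMul :
    ContDiffAt ℝ ∞ (chartMul E G) (unitCoord E G, unitCoord E G) := by
  rw [← contMDiffAt_iff_contDiffAt]
  have h1 : ContMDiffAt 𝓘(ℝ, E × E) 𝓘(ℝ, E) ∞ (fun p : E × E => (unitChart E G).symm p.1)
      (unitCoord E G, unitCoord E G) :=
    ContMDiffAt.comp (I' := 𝓘(ℝ, E)) _ (contMDiffAt_unitChart_symm (E := E) (G := G))
      contDiff_fst.contMDiff.contMDiffAt
  have h2 : ContMDiffAt 𝓘(ℝ, E × E) 𝓘(ℝ, E) ∞ (fun p : E × E => (unitChart E G).symm p.2)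
      (unitCoord E G, unitCoord E G) :=
    ContMDiffAt.comp (I' := 𝓘(ℝ, E)) _ (contMDiffAt_unitChart_symm (E := E) (G := G))
      contDiff_snd.contMDiff.contMDiffAt
  refine ContMDiffAt.comp_of_eq (contMDiffAt_unitChart (E := E) (G := G)) (h1.mul h2) ?_
  simp

theorem contDiffAt_chartConj :
    ContDiffAt ℝ ∞ (chartConj E G) (unitCoord E G, unitCoord E G) := by
  rw [← contMDiffAt_iff_contDiffAt]
  have h1 : ContMDiffAt 𝓘(ℝ, E × E) 𝓘(ℝ, E) ∞ (fun p : E × E => (unitChart E G).symm p.1)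
      (unitCoord E G, unitCoord E G) :=
    ContMDiffAt.comp (I' := 𝓘(ℝ, E)) _ (contMDiffAt_unitChart_symm (E := E) (G := G))
      contDiff_fst.contMDiff.contMDiffAt
  have h2 : ContMDiffAt 𝓘(ℝ, E × E) 𝓘(ℝ, E) ∞ (fun p : E × E => (unitChart E G).symm p.2)
      (unitCoord E G, unitCoord E G) :=
    ContMDiffAt.comp (I' := 𝓘(ℝ, E)) _ (contMDiffAt_unitChart_symm (E := E) (G := G))
      contDiff_snd.contMDiff.contMDiffAt
  refine ContMDiffAt.comp_of_eq (contMDiffAt_unitChart (E := E) (G := G))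
    ((h1.mul h2).mul h1.inv) ?_
  simp

theorem contDiffAt_chartRight : ContDiffAt ℝ ∞ (chartRight E G) (unitCoord E G) := by
  refine ContDiffAt.fderiv (n := ∞) (f := fun b a => chartMul E G (a, b))
    (g := fun _ => unitCoord E G) ?_ contDiffAt_const (by simp)
  exact (contDiffAt_chartMul (E := E) (G := G)).comp (unitCoord E G, unitCoord E G)
    (contDiffAt_snd.prodMk contDiffAt_fst)

theorem contDiffAt_chartLeft : ContDiffAt ℝ ∞ (chartLeft E G) (unitCoord E G) :=
  ContDiffAt.fderiv (n := ∞) (f := fun a b => chartMul E G (a, b))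
    (g := fun _ => unitCoord E G) contDiffAt_chartMul contDiffAt_const (by simp)

/-- Symmetry of the second derivative of the multiplication: differentiating first in one factor
and then in the other gives the same result in both orders. -/
theorem fderiv_chartRight_apply (v w : E) :
    fderiv ℝ (chartRight E G) (unitCoord E G) v w =
      fderiv ℝ (chartLeft E G) (unitCoord E G) w v := by
  set e := unitCoord E G
  have hm := contDiffAt_chartMul (E := E) (G := G)
  have hd : ∀ᶠ p in 𝓝 (e, e), DifferentiableAt ℝ (chartMul E G) p :=
    ((hm.of_le (m := 1) (by simp)).eventually (by simp)).mono fun p hp =>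
      hp.differentiableAt one_ne_zero
  have hR : ∀ᶠ b in 𝓝 e, chartRight E G b =
      (fderiv ℝ (chartMul E G) (e, b)).comp (ContinuousLinearMap.inl ℝ E E) := by
    have : Tendsto (fun b : E => (e, b)) (𝓝 e) (𝓝 (e, e)) := by
      exact (Continuous.prodMk_right e).tendsto e
    filter_upwards [this.eventually hd] with b hb
    exact (HasFDerivAt.comp (f := fun a => (a, b)) e hb.hasFDerivAt
      (hasFDerivAt_prodMk_left e b)).fderiv
  have hL : ∀ᶠ b in 𝓝 e, chartLeft E G b =
      (fderiv ℝ (chartMul E G) (b, e)).comp (ContinuousLinearMap.inr ℝ E E) := by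
    have : Tendsto (fun b : E => (b, e)) (𝓝 e) (𝓝 (e, e)) := by
      exact (Continuous.prodMk_left e).tendsto e
    filter_upwards [this.eventually hd] with b hb
    exact (HasFDerivAt.comp (f := fun a => (b, a)) e hb.hasFDerivAt
      (hasFDerivAt_prodMk_right b e)).fderiv
  have h2 : HasFDerivAt (fderiv ℝ (chartMul E G)) (fderiv ℝ (fderiv ℝ (chartMul E G)) (e, e))
      (e, e) :=
    ((hm.fderiv_right (m := ∞) (by simp)).differentiableAt (by simp)).hasFDerivAt
  have hR' := (((ContinuousLinearMap.compL ℝ E (E × E) E).flip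
    (ContinuousLinearMap.inl ℝ E E)).hasFDerivAt.comp e
      (HasFDerivAt.comp (f := fun b => (e, b)) e h2
        (hasFDerivAt_prodMk_right e e))).congr_of_eventuallyEq hR
  have hL' := (((ContinuousLinearMap.compL ℝ E (E × E) E).flip
    (ContinuousLinearMap.inr ℝ E E)).hasFDerivAt.comp e
      (HasFDerivAt.comp (f := fun b => (b, e)) e h2
        (hasFDerivAt_prodMk_left e e))).congr_of_eventuallyEq hL
  rw [hR'.fderiv, hL'.fderiv]
  have hs := second_derivative_symmetric_of_eventually
    (hd.mono fun p hp => hp.hasFDerivAt) h2 (0, v) (w, 0)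
  simpa using hs

end UnitChart

/-! ### The adjoint representation and the Lie bracket -/

section Adjoint

open VectorField

variable {E : Type*} [NormedAddCommGroup E] [NormedSpace ℝ E]
variable {G : Type*} [TopologicalSpace G] [ChartedSpace E G] [Group G]
variable {M : Type*} [NormedAddCommGroup M] [NormedSpace ℝ M]

/-- At a point which is mapped to the identity, derivatives can be computed in the chart at the
identity. -/
theorem hasMFDerivAt_iff_of_eq_one {f : M → G} {y : M} (hf : f y = 1) {D : M →L[ℝ] E} :
    HasMFDerivAt 𝓘(ℝ, M) 𝓘(ℝ, E) f y D ↔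
      ContinuousAt f y ∧ HasFDerivAt (fun z => unitChart E G (f z)) D y := by
  have h : HasMFDerivAt 𝓘(ℝ, M) 𝓘(ℝ, E) f y D ↔
      ContinuousAt f y ∧ HasFDerivWithinAt (extChartAt 𝓘(ℝ, E) (f y) ∘ f ∘ id) D
        (Set.range id) y := Iff.rfl
  rw [h, hf, Set.range_id, hasFDerivWithinAt_univ]
  rfl

theorem HasMFDerivAt.hasFDerivAt_unitChart {f : G → G} (hf : f 1 = 1) {D : E →L[ℝ] E}
    (h : HasMFDerivAt 𝓘(ℝ, E) 𝓘(ℝ, E) f 1 D) :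
    HasFDerivAt (fun b => unitChart E G (f ((unitChart E G).symm b))) D (unitCoord E G) := by
  have h2 : HasFDerivWithinAt (extChartAt 𝓘(ℝ, E) (f 1) ∘ f ∘ (unitChart E G).symm) D
      (Set.range id) (unitCoord E G) := h.2
  rwa [hf, Set.range_id, hasFDerivWithinAt_univ] at h2

theorem HasMFDerivAt.hasFDerivAt_unitChart_symm {f : G → M} {D : E →L[ℝ] M}
    (h : HasMFDerivAt 𝓘(ℝ, E) 𝓘(ℝ, M) f 1 D) :
    HasFDerivAt (fun b => f ((unitChart E G).symm b)) D (unitCoord E G) := by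
  have h2 : HasFDerivWithinAt (f ∘ (unitChart E G).symm) D
      (Set.range id) (unitCoord E G) := h.2
  rwa [Set.range_id, hasFDerivWithinAt_univ] at h2

variable [LieGroup 𝓘(ℝ, E) ∞ G]

theorem hasMFDerivAt_conj (g : G) :
    HasMFDerivAt 𝓘(ℝ, E) 𝓘(ℝ, E) (fun x : G => g * x * g⁻¹) 1 (Ad (E := E) g) := by
  have h : MDifferentiableAt 𝓘(ℝ, E) 𝓘(ℝ, E) (fun x : G => g * x * g⁻¹) 1 :=
    ((contMDiff_mul_right (I := 𝓘(ℝ, E)) (n := ∞) (a := g⁻¹)).comp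
      (contMDiff_mul_left (I := 𝓘(ℝ, E)) (n := ∞) (a := g))).mdifferentiable (by simp) 1
  exact h.hasMFDerivAt

theorem hasFDerivAt_conj (g : G) :
    HasFDerivAt (fun b => unitChart E G (g * (unitChart E G).symm b * g⁻¹)) (Ad (E := E) g)
      (unitCoord E G) :=
  HasMFDerivAt.hasFDerivAt_unitChart (by simp) (hasMFDerivAt_conj g)

variable (G) in
/-- The Lie bracket in terms of the multiplication in the chart at the identity. -/
theorem bracket_eq (v w : E) :
    bracket G v w = fderiv ℝ (chartLeft E G) (unitCoord E G) v w -
      fderiv ℝ (chartLeft E G) (unitCoord E G) w v := by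
  have : IsManifold 𝓘(ℝ, E) ∞ G := ContMDiffMul.toIsManifold
  have : IsManifold 𝓘(ℝ, E) 1 G := IsManifold.of_le (n := ∞) (by simp)
  -- The left-invariant fields, read in the chart at the identity.
  obtain ⟨X, hX⟩ : ∃ X : E → E → E, ∀ u a, X u a =
      mpullbackWithin 𝓘(ℝ, E) 𝓘(ℝ, E) (extChartAt 𝓘(ℝ, E) (1 : G)).symm
        (mulInvariantVectorField (I := 𝓘(ℝ, E)) (G := G) u) (Set.range 𝓘(ℝ, E)) a :=
    ⟨_, fun _ _ => rfl⟩
  have key : ∀ u : E, X u =ᶠ[𝓝 (unitCoord E G)] fun a => chartLeft E G a u := by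
    intro u
    filter_upwards [extChartAt_target_mem_nhds (I := 𝓘(ℝ, E)) (1 : G)] with a ha
    have hsrc := (extChartAt 𝓘(ℝ, E) (1 : G)).map_target ha
    have hinv := ContinuousLinearMap.inverse_eq
      (mfderivWithin_extChartAt_symm_comp_mfderiv_extChartAt ha)
      (mfderiv_extChartAt_comp_mfderivWithin_extChartAt_symm ha)
    have h1 : MDifferentiableAt 𝓘(ℝ, E) 𝓘(ℝ, E)
        (fun x : G => (unitChart E G).symm a * x) 1 :=
      (contMDiff_mul_left (I := 𝓘(ℝ, E)) (n := ∞)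
        (a := (unitChart E G).symm a)).mdifferentiable (by simp) 1
    have h2 : MDifferentiableAt 𝓘(ℝ, E) 𝓘(ℝ, E) (extChartAt 𝓘(ℝ, E) (1 : G))
        ((unitChart E G).symm a) :=
      mdifferentiableAt_extChartAt (by rwa [extChartAt_source] at hsrc)
    have h2' : MDifferentiableAt 𝓘(ℝ, E) 𝓘(ℝ, E) (extChartAt 𝓘(ℝ, E) (1 : G))
        ((unitChart E G).symm a * 1) := by rwa [mul_one]
    have h3 := HasMFDerivAt.comp (1 : G) h2'.hasMFDerivAt h1.hasMFDerivAt
    have h4 := (HasMFDerivAt.hasFDerivAt_unitChart_symm (M := E) h3).fderiv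
    rw [hX, mpullbackWithin_apply, hinv]
    have h5 : chartLeft E G a = _ := h4
    rw [h5]
    change _ = (mfderiv 𝓘(ℝ, E) 𝓘(ℝ, E) (extChartAt 𝓘(ℝ, E) (1 : G))
        ((unitChart E G).symm a * 1)) (mfderiv 𝓘(ℝ, E) 𝓘(ℝ, E)
          (fun x : G => (unitChart E G).symm a * x) 1 u)
    rw [mul_one]
    rfl
  -- The bracket of `𝔤` is by definition the bracket of these fields at the identity.
  have hd : ∀ u : E, HasFDerivAt (fun a => chartLeft E G a u)
      ((fderiv ℝ (chartLeft E G) (unitCoord E G)).flip u) (unitCoord E G) := fun u =>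
    ((contDiffAt_chartLeft (E := E) (G := G)).differentiableAt (by simp)).hasFDerivAt.clm_apply
      (hasFDerivAt_const u _) |>.congr_fderiv (by ext; simp)
  have h0 : ∃ D : E →L[ℝ] E, D = ContinuousLinearMap.id ℝ E ∧ bracket G v w = D.inverse
    (lieBracketWithin ℝ (X v) (X w) (Set.univ ∩ Set.univ) (unitCoord E G)) := by
    refine ⟨mfderiv 𝓘(ℝ, E) 𝓘(ℝ, E) (extChartAt 𝓘(ℝ, E) (1 : G)) 1, mfderiv_extChartAt_self, ?_⟩
    have : (Set.univ ∩ Set.univ : Set E) =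
      ((extChartAt 𝓘(ℝ, E) (1 : G)).symm ⁻¹' Set.univ ∩ Set.range 𝓘(ℝ, E)) := by simp
    rw [this, show X v = _ from funext (hX v), show X w = _ from funext (hX w)]
    rfl
  obtain ⟨D, hD, h6⟩ := h0
  rw [h6, hD, ContinuousLinearMap.inverse_id, Set.inter_univ, lieBracketWithin_univ,
    (key v).lieBracket_vectorField_eq (key w),
    lieBracket, (hd v).fderiv, (hd w).fderiv, chartLeft_unitCoord]
  rfl

variable (E G) in
/-- The map `g ↦ Ad_g` in the chart at the identity. -/
def chartAd (a : E) : E →L[ℝ] E := Ad ((unitChart E G).symm a)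

theorem chartAd_eq (a : E) :
    chartAd E G a = fderiv ℝ (fun b => chartConj E G (a, b)) (unitCoord E G) :=
  (hasFDerivAt_conj _).fderiv.symm

theorem contDiffAt_chartAd : ContDiffAt ℝ ∞ (chartAd E G) (unitCoord E G) := by
  have h : ContDiffAt ℝ ∞ (fun a => fderiv ℝ (fun b => chartConj E G (a, b)) (unitCoord E G))
      (unitCoord E G) :=
    ContDiffAt.fderiv (n := ∞) (f := fun a b => chartConj E G (a, b))
      (g := fun _ => unitCoord E G) contDiffAt_chartConj contDiffAt_const (by simp)
  exact h.congr_of_eventuallyEq (Eventually.of_forall chartAd_eq)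

/-- The left-invariant field with value `w` at the identity coincides at `g` with the
right-invariant one with value `Ad_g w`. -/
theorem chartRight_chartAd :
    ∀ᶠ a in 𝓝 (unitCoord E G), ∀ w, chartRight E G a (chartAd E G a w) = chartLeft E G a w := by
  have := isTopologicalGroup E (G := G) inferInstance
  set e := unitCoord E G
  have hm : ∀ᶠ p in 𝓝 (e, e), DifferentiableAt ℝ (chartMul E G) p :=
    (((contDiffAt_chartMul (E := E) (G := G)).of_le (m := 1) (by simp)).eventually
      (by simp)).mono fun p hp => hp.differentiableAt one_ne_zero
  have h1 : Tendsto (fun b : E => (e, b)) (𝓝 e) (𝓝 (e, e)) := (Continuous.prodMk_right e).tendsto e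
  filter_upwards [h1.eventually hm, eventually_unitChart_right_inv (E := E) (G := G)]
    with a ha1 ha2 w
  have hg : Tendsto (fun b => (unitChart E G).symm a * (unitChart E G).symm b *
      ((unitChart E G).symm a)⁻¹) (𝓝 e) (𝓝 1) := by
    have := (((tendsto_const_nhds (x := (unitChart E G).symm a)).mul
      (tendsto_unitChart_symm (E := E) (G := G))).mul
      (tendsto_const_nhds (x := ((unitChart E G).symm a)⁻¹)))
    simpa using this
  have hev : ∀ᶠ b in 𝓝 e, chartMul E G (chartConj E G (a, b), a) = chartMul E G (a, b) := by
    filter_upwards [hg.eventually (eventually_unitChart_left_inv (E := E) (G := G))] with b hb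
    simp only [chartMul, chartConj]
    rw [hb]
    simp
  have hR : HasFDerivAt (fun b => chartMul E G (b, a)) (chartRight E G a) e :=
    (HasFDerivAt.comp (f := fun b => (b, a)) e ha1.hasFDerivAt
      (hasFDerivAt_prodMk_left e a)).differentiableAt.hasFDerivAt
  have hC : HasFDerivAt (fun b => chartConj E G (a, b)) (chartAd E G a) e :=
    hasFDerivAt_conj (E := E) ((unitChart E G).symm a)
  have hCe : chartConj E G (a, e) = e := by simp [chartConj, e]
  have := HasFDerivAt.comp (f := fun b => chartConj E G (a, b)) e (by rw [hCe]; exact hR) hC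
  have h3 := (this.congr_of_eventuallyEq (hev.mono fun b hb => hb.symm)).fderiv
  have h4 : chartLeft E G a = (chartRight E G a).comp (chartAd E G a) := h3
  rw [h4]
  rfl

/-- The derivative of `g ↦ Ad_g` at the identity is the Lie bracket. -/
theorem fderiv_chartAd (v w : E) :
    fderiv ℝ (chartAd E G) (unitCoord E G) v w = bracket G v w := by
  have hA := ((contDiffAt_chartAd (E := E) (G := G)).differentiableAt (by simp)).hasFDerivAt
  have hR := ((contDiffAt_chartRight (E := E) (G := G)).differentiableAt (by simp)).hasFDerivAt
  have hL := ((contDiffAt_chartLeft (E := E) (G := G)).differentiableAt (by simp)).hasFDerivAt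
  -- Differentiate the identity `chartRight ∘ Ad = chartLeft` at the identity.
  have h1 := hR.clm_apply (hA.clm_apply (hasFDerivAt_const w (unitCoord E G)))
  have h2 := hL.clm_apply (hasFDerivAt_const w (unitCoord E G))
  have h3 := h1.unique (h2.congr_of_eventuallyEq (chartRight_chartAd.mono fun a ha => ha w))
  have h4 := DFunLike.congr_fun h3 v
  have h5 : chartAd E G (unitCoord E G) = ContinuousLinearMap.id ℝ E := by
    simp [chartAd, Ad_one]
  simp [chartRight_unitCoord, h5, fderiv_chartRight_apply] at h4
  rw [bracket_eq, ← h4]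
  simp

end Adjoint

/-! ### Right logarithmic derivatives -/

section LogDeriv

variable {E : Type*} [NormedAddCommGroup E] [NormedSpace ℝ E]
variable {G : Type*} [TopologicalSpace G] [ChartedSpace E G] [Group G]
variable {M : Type*} [NormedAddCommGroup M] [NormedSpace ℝ M]
variable {N : Type*} [NormedAddCommGroup N] [NormedSpace ℝ N]

/-- `ρ` is the right logarithmic derivative `dg · g⁻¹` at `y` of the map `g` from a vector space
to the group `G`. It is computed on `z ↦ g z (g y)⁻¹`, which maps `y` to the identity, so that only
the chart at the identity is involved. -/
def HasLogDerivAt (g : M → G) (ρ : M →L[ℝ] E) (y : M) : Prop :=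
  ContinuousAt g y ∧ HasFDerivAt (fun z => unitChart E G (g z * (g y)⁻¹)) ρ y

theorem HasLogDerivAt.unique {g : M → G} {ρ ρ' : M →L[ℝ] E} {y : M} (h : HasLogDerivAt g ρ y)
    (h' : HasLogDerivAt g ρ' y) : ρ = ρ' :=
  h.2.unique h'.2

theorem HasLogDerivAt.congr_deriv {g : M → G} {ρ ρ' : M →L[ℝ] E} {y : M}
    (h : HasLogDerivAt g ρ y) (h' : ρ = ρ') : HasLogDerivAt g ρ' y :=
  h' ▸ h

theorem hasLogDerivAt_const (c : G) (y : M) : HasLogDerivAt (fun _ => c) (0 : M →L[ℝ] E) y :=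
  ⟨continuousAt_const, hasFDerivAt_const _ _⟩

theorem HasLogDerivAt.comp {g : M → G} {ρ : M →L[ℝ] E} {f : N → M} {f' : N →L[ℝ] M} {y : N}
    (hg : HasLogDerivAt g ρ (f y)) (hf : HasFDerivAt f f' y) :
    HasLogDerivAt (fun z => g (f z)) (ρ.comp f') y :=
  ⟨hg.1.comp hf.continuousAt, HasFDerivAt.comp y hg.2 hf⟩

variable [LieGroup 𝓘(ℝ, E) ∞ G]

theorem HasLogDerivAt.tendsto {g : M → G} {ρ : M →L[ℝ] E} {y : M} (h : HasLogDerivAt g ρ y) :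
    Tendsto (fun z => g z * (g y)⁻¹) (𝓝 y) (𝓝 1) := by
  have := isTopologicalGroup E (G := G) inferInstance
  have h1 := h.1.tendsto.mul (tendsto_const_nhds (x := (g y)⁻¹))
  rwa [mul_inv_cancel] at h1

theorem hasFDerivAt_chartMul_unit :
    HasFDerivAt (chartMul E G) (ContinuousLinearMap.fst ℝ E E + ContinuousLinearMap.snd ℝ E E)
      (unitCoord E G, unitCoord E G) := by
  set e := unitCoord E G with he
  have h := ((contDiffAt_chartMul (E := E) (G := G)).differentiableAt (by simp)).hasFDerivAt
  have h1 := (HasFDerivAt.comp (f := fun b => (b, e)) e h (hasFDerivAt_prodMk_left e e)).fderiv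
  have h2 := (HasFDerivAt.comp (f := fun b => (e, b)) e h (hasFDerivAt_prodMk_right e e)).fderiv
  rw [show fderiv ℝ (chartMul E G ∘ fun b => (b, e)) e = _ from chartRight_unitCoord] at h1
  rw [show fderiv ℝ (chartMul E G ∘ fun b => (e, b)) e = _ from chartLeft_unitCoord] at h2
  refine h.congr_fderiv ?_
  rw [← ContinuousLinearMap.coprod_comp_inl_inr
    (fderiv ℝ (chartMul E G) (unitCoord E G, unitCoord E G)), ← h1, ← h2]
  ext <;> simp

/-- The product rule `d(gk) (gk)⁻¹ = dg g⁻¹ + Ad_g (dk k⁻¹)`. -/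
theorem HasLogDerivAt.mul {g k : M → G} {ρ σ : M →L[ℝ] E} {y : M} (hg : HasLogDerivAt g ρ y)
    (hk : HasLogDerivAt k σ y) :
    HasLogDerivAt (fun z => g z * k z) (ρ + (Ad (g y)).comp σ) y := by
  have := isTopologicalGroup E (G := G) inferInstance
  refine ⟨hg.1.mul hk.1, ?_⟩
  have h1 : HasFDerivAt (fun z => unitChart E G (g y * (k z * (k y)⁻¹) * (g y)⁻¹))
      ((Ad (g y)).comp σ) y := by
    have h2 := HasFDerivAt.comp (f := fun z => unitChart E G (k z * (k y)⁻¹)) y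
      (by simpa using hasFDerivAt_conj (E := E) (g y)) hk.2
    refine h2.congr_of_eventuallyEq ?_
    filter_upwards [hk.tendsto.eventually (eventually_unitChart_left_inv (E := E) (G := G))]
      with z hz
    simp only [comp_apply, hz]
  have h3 := HasFDerivAt.comp
    (f := fun z => (unitChart E G (g z * (g y)⁻¹),
      unitChart E G (g y * (k z * (k y)⁻¹) * (g y)⁻¹))) y
    (by simpa using hasFDerivAt_chartMul_unit (E := E) (G := G)) (hg.2.prodMk h1)
  have ht : Tendsto (fun z => g y * (k z * (k y)⁻¹) * (g y)⁻¹) (𝓝 y) (𝓝 1) := by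
    have := (tendsto_const_nhds (x := g y)).mul
      (hk.tendsto.mul (tendsto_const_nhds (x := (g y)⁻¹)))
    simpa [mul_assoc] using this
  refine (h3.congr_of_eventuallyEq ?_).congr_fderiv ?_
  · filter_upwards [hg.tendsto.eventually (eventually_unitChart_left_inv (E := E) (G := G)),
      ht.eventually (eventually_unitChart_left_inv (E := E) (G := G))] with z hz1 hz2
    simp only [comp_apply, chartMul, hz1, hz2]
    congr 1
    group
  · ext; simp

theorem HasLogDerivAt.mul_const {g : M → G} {ρ : M →L[ℝ] E} {y : M} (hg : HasLogDerivAt g ρ y)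
    (c : G) : HasLogDerivAt (fun z => g z * c) ρ y :=
  (hg.mul (hasLogDerivAt_const c y)).congr_deriv (by simp)

theorem HasLogDerivAt.const_mul {g : M → G} {ρ : M →L[ℝ] E} {y : M} (hg : HasLogDerivAt g ρ y)
    (c : G) : HasLogDerivAt (fun z => c * g z) ((Ad c).comp ρ) y :=
  ((hasLogDerivAt_const c y).mul hg).congr_deriv (by simp)

/-- The logarithmic derivative is the right trivialisation of the derivative. -/
theorem HasMFDerivAt.hasLogDerivAt {g : M → G} {y : M} {D : M →L[ℝ] E}
    (h : HasMFDerivAt 𝓘(ℝ, M) 𝓘(ℝ, E) g y D) :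
    HasLogDerivAt g ((show E →L[ℝ] E from rightTriv (g y)).comp D) y := by
  have h2 : MDifferentiableAt 𝓘(ℝ, E) 𝓘(ℝ, E) (fun x : G => x * (g y)⁻¹) (g y) :=
    (contMDiff_mul_right (I := 𝓘(ℝ, E)) (n := ∞) (a := (g y)⁻¹)).mdifferentiable (by simp) _
  have h3 := HasMFDerivAt.comp y h2.hasMFDerivAt h
  exact ⟨h.1, ((hasMFDerivAt_iff_of_eq_one (f := fun z => g z * (g y)⁻¹) (by simp)).1 h3).2⟩

theorem HasLogDerivAt.mdifferentiableAt {g : M → G} {y : M} {ρ : M →L[ℝ] E}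
    (h : HasLogDerivAt g ρ y) : MDifferentiableAt 𝓘(ℝ, M) 𝓘(ℝ, E) g y := by
  have := isTopologicalGroup E (G := G) inferInstance
  have h1 : HasMFDerivAt 𝓘(ℝ, M) 𝓘(ℝ, E) (fun z => g z * (g y)⁻¹) y ρ :=
    (hasMFDerivAt_iff_of_eq_one (by simp)).2 ⟨h.1.mul continuousAt_const, h.2⟩
  have h2 : MDifferentiable 𝓘(ℝ, E) 𝓘(ℝ, E) (fun x : G => x * g y) :=
    (contMDiff_mul_right (I := 𝓘(ℝ, E)) (n := ∞) (a := g y)).mdifferentiable (by simp)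
  have h3 := (h2 (g y * (g y)⁻¹)).comp y h1.mdifferentiableAt
  have h4 : (fun x : G => x * g y) ∘ (fun z => g z * (g y)⁻¹) = g := by
    funext z; simp
  rwa [h4] at h3

variable (E G) in
/-- The points of the chart at the identity over which right translations are differentiable in
the chart. -/
def unitDomain : Set G :=
  {x | x ∈ (unitChart E G).source ∧
    DifferentiableAt ℝ (fun a => chartMul E G (a, unitChart E G x)) (unitCoord E G)}

theorem unitDomain_mem_nhds : unitDomain E G ∈ 𝓝 (1 : G) := by
  have h1 : Tendsto (fun b : E => (unitCoord E G, b)) (𝓝 (unitCoord E G))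
      (𝓝 (unitCoord E G, unitCoord E G)) := (Continuous.prodMk_right _).tendsto _
  have h2 := (((contDiffAt_chartMul (E := E) (G := G)).of_le (m := 1) (by simp)).eventually
      (by simp)).mono fun p hp => hp.differentiableAt one_ne_zero
  filter_upwards [(extChartAt_source_mem_nhds (I := 𝓘(ℝ, E)) (1 : G)),
    (continuousAt_unitChart (E := E) (G := G)).eventually (h1.eventually h2)] with x hx1 hx2
  exact ⟨hx1, (HasFDerivAt.comp (f := fun b => (b, _)) _ hx2.hasFDerivAt
      (hasFDerivAt_prodMk_left _ _)).differentiableAt⟩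

/-- The logarithmic derivative determines the derivative in the chart at the identity. -/
theorem HasLogDerivAt.hasFDerivAt_unitChart {g : M → G} {ρ : M →L[ℝ] E} {y : M}
    (h : HasLogDerivAt g ρ y) (hy : g y ∈ unitDomain E G) :
    HasFDerivAt (fun z => unitChart E G (g z))
      ((chartRight E G (unitChart E G (g y))).comp ρ) y := by
  have h1 : HasFDerivAt (fun a => chartMul E G (a, unitChart E G (g y)))
      (chartRight E G (unitChart E G (g y))) (unitCoord E G) := hy.2.hasFDerivAt
  refine (HasFDerivAt.comp (f := fun z => unitChart E G (g z * (g y)⁻¹)) y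
    (by simpa using h1) h.2).congr_of_eventuallyEq ?_
  filter_upwards [h.tendsto.eventually (eventually_unitChart_left_inv (E := E) (G := G))] with z hz
  simp [chartMul, hz, (unitChart E G).left_inv hy.1]

/-- A map into `G` with continuous logarithmic derivative is `C¹`: near each point it is the product
of a constant and of a map with values in the chart at the identity. -/
theorem contMDiffAt_of_hasLogDerivAt {g : M → G} {ρ : M → M →L[ℝ] E} {y : M}
    (h : ∀ z, HasLogDerivAt g (ρ z) z) (hρ : Continuous ρ) :
    ContMDiffAt 𝓘(ℝ, M) 𝓘(ℝ, E) 1 g y := by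
  have := isTopologicalGroup E (G := G) inferInstance
  have hc : Continuous g := continuous_iff_continuousAt.2 fun z => (h z).1
  set k : M → G := fun z => g z * (g y)⁻¹
  have hk : ∀ z, HasLogDerivAt k (ρ z) z := fun z => (h z).mul_const _
  have hkc : Continuous k := hc.mul continuous_const
  have hky : k y = 1 := by simp [k]
  have hA : ∀ᶠ z in 𝓝 y, k z ∈ unitDomain E G ∧
      ContinuousAt (chartRight E G) (unitChart E G (k z)) := by
    have h1 : Tendsto k (𝓝 y) (𝓝 1) := hky ▸ hkc.tendsto y
    have h2 := ((contDiffAt_chartRight (E := E) (G := G)).of_le (m := 1) (by simp)).eventually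
      (by simp)
    filter_upwards [h1.eventually (unitDomain_mem_nhds (E := E) (G := G)),
      h1.eventually ((continuousAt_unitChart (E := E) (G := G)).eventually h2)] with z hz1 hz2
    exact ⟨hz1, hz2.continuousAt⟩
  have h1 : ContDiffAt ℝ 1 (fun z => unitChart E G (k z)) y := by
    rw [contDiffAt_one_iff]
    refine ⟨fun z => (chartRight E G (unitChart E G (k z))).comp (ρ z), _, hA, ?_, ?_⟩
    · intro z hz
      refine ContinuousAt.continuousWithinAt ?_
      refine ContinuousAt.clm_comp (ContinuousAt.comp (f := fun z => unitChart E G (k z)) hz.2 ?_)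
        hρ.continuousAt
      exact ((hk z).hasFDerivAt_unitChart hz.1).continuousAt
    · exact fun z hz => (hk z).hasFDerivAt_unitChart hz.1
  have h2 : ContMDiffAt 𝓘(ℝ, M) 𝓘(ℝ, E) 1 (fun z => (unitChart E G).symm (unitChart E G (k z))) y :=
    ContMDiffAt.comp_of_eq (y := unitCoord E G)
      ((contMDiffAt_unitChart_symm (E := E) (G := G)).of_le (by simp))
      h1.contMDiffAt (by simp [hky])
  have h3 : ContMDiffAt 𝓘(ℝ, M) 𝓘(ℝ, E) 1 (fun z =>
      (unitChart E G).symm (unitChart E G (k z)) * g y) y :=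
    ContMDiffAt.comp y ((contMDiff_mul_right (I := 𝓘(ℝ, E)) (n := ∞)
      (a := g y)).contMDiffAt.of_le (by simp)) h2
  refine h3.congr_of_eventuallyEq ?_
  filter_upwards [hA] with z hz
  rw [(unitChart E G).left_inv hz.1.1]
  simp [k]

end LogDeriv

/-! ### One-parameter subgroups and the exponential map -/

section OneParameter

variable {E : Type*} [NormedAddCommGroup E] [NormedSpace ℝ E]
variable {G : Type*} [TopologicalSpace G] [Group G]

theorem IsOneParameterSubgroup.map_zero {H : Type*} [TopologicalSpace H]
    {I : ModelWithCorners ℝ E H} [ChartedSpace H G] {γ : ℝ → G} {ξ : E}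
    (h : IsOneParameterSubgroup I γ ξ) : γ 0 = 1 := by
  have := h.1 0 0
  rw [add_zero] at this
  exact mul_eq_left.1 this.symm

theorem IsOneParameterSubgroup.hasMFDerivAt_zero {H : Type*} [TopologicalSpace H]
    {I : ModelWithCorners ℝ E H} [ChartedSpace H G] {γ : ℝ → G} {ξ : E}
    (h : IsOneParameterSubgroup I γ ξ) :
    HasMFDerivAt 𝓘(ℝ, ℝ) I γ 0 ((1 : ℝ →L[ℝ] ℝ).smulRight ξ : ℝ →L[ℝ] E) := by
  have h1 : HasMFDerivAt 𝓘(ℝ, ℝ) I γ 0 (mfderiv 𝓘(ℝ, ℝ) I γ 0) :=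
    (h.2.1.mdifferentiable (by simp) 0).hasMFDerivAt
  have h2 : (show ℝ →L[ℝ] E from mfderiv 𝓘(ℝ, ℝ) I γ 0) = (1 : ℝ →L[ℝ] ℝ).smulRight ξ := by
    ext
    simpa using! h.2.2
  rw [← h2]
  exact h1

variable [ChartedSpace E G]

theorem mulInvariantVectorField_one (ξ : GroupLieAlgebra 𝓘(ℝ, E) G) :
    mulInvariantVectorField ξ (1 : G) = ξ := by
  have : (fun y : G => 1 * y) = id := by funext; simp
  rw [mulInvariantVectorField, this, mfderiv_id]
  rfl

theorem hasLogDerivAt_of_map_add {γ : ℝ → G} {ξ : E} (hadd : ∀ s t, γ (s + t) = γ s * γ t)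
    (h0 : γ 0 = 1) (hc : Continuous γ)
    (hd : HasMFDerivAt 𝓘(ℝ, ℝ) 𝓘(ℝ, E) γ 0 ((1 : ℝ →L[ℝ] ℝ).smulRight ξ : ℝ →L[ℝ] E)) (t : ℝ) :
    HasLogDerivAt γ ((1 : ℝ →L[ℝ] ℝ).smulRight ξ) t := by
  refine ⟨hc.continuousAt, ?_⟩
  have h1 := ((hasMFDerivAt_iff_of_eq_one h0).1 hd).2
  have h2 : (fun s => unitChart E G (γ s * (γ t)⁻¹)) = fun s => unitChart E G (γ (s - t)) := by
    funext s
    have h3 : γ s = γ (s - t) * γ t := by rw [← hadd, sub_add_cancel]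
    rw [h3, mul_inv_cancel_right]
  rw [h2]
  exact HasFDerivAt.comp (f := fun s : ℝ => s - t) t (by simpa using h1)
    ((hasFDerivAt_id t).sub_const t)

theorem IsOneParameterSubgroup.hasLogDerivAt {γ : ℝ → G} {ξ : E}
    (h : IsOneParameterSubgroup 𝓘(ℝ, E) γ ξ) (t : ℝ) :
    HasLogDerivAt γ ((1 : ℝ →L[ℝ] ℝ).smulRight ξ) t :=
  hasLogDerivAt_of_map_add h.1 h.map_zero h.2.1.continuous h.hasMFDerivAt_zero t

theorem IsOneParameterSubgroup.comp_mul {γ : ℝ → G} {ξ : E}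
    (h : IsOneParameterSubgroup 𝓘(ℝ, E) γ ξ) (c : ℝ) :
    IsOneParameterSubgroup 𝓘(ℝ, E) (fun t => γ (c * t)) (c • ξ) := by
  have h0 : HasMFDerivAt 𝓘(ℝ, ℝ) 𝓘(ℝ, E) γ (c * 0)
      ((1 : ℝ →L[ℝ] ℝ).smulRight ξ : ℝ →L[ℝ] E) := by
    -- The point is a variable, since the type of the derivative depends on it.
    have : ∀ r : ℝ, r = 0 → HasMFDerivAt 𝓘(ℝ, ℝ) 𝓘(ℝ, E) γ r
        ((1 : ℝ →L[ℝ] ℝ).smulRight ξ : ℝ →L[ℝ] E) := by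
      rintro _ rfl
      exact h.hasMFDerivAt_zero
    exact this _ (mul_zero c)
  have h1 : HasMFDerivAt 𝓘(ℝ, ℝ) 𝓘(ℝ, ℝ) (fun s : ℝ => c * s) 0
      (c • ContinuousLinearMap.id ℝ ℝ) := ((hasFDerivAt_id (0 : ℝ)).const_mul c).hasMFDerivAt
  have h2 := (HasMFDerivAt.comp (f := fun s : ℝ => c * s) (0 : ℝ) h0 h1).mfderiv
  refine ⟨fun s t => by simp only [← h.1, mul_add],
    h.2.1.comp (contDiff_const.mul contDiff_id).contMDiff, ?_⟩
  have h3 : (show ℝ →L[ℝ] E from mfderiv 𝓘(ℝ, ℝ) 𝓘(ℝ, E) (fun s => γ (c * s)) 0) =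
      ((1 : ℝ →L[ℝ] ℝ).smulRight ξ).comp (c • ContinuousLinearMap.id ℝ ℝ) := h2
  have h4 := DFunLike.congr_fun h3 (1 : ℝ)
  simpa using! h4

variable [LieGroup 𝓘(ℝ, E) ∞ G]

theorem hasMFDerivAt_mul_left (x g : G) :
    HasMFDerivAt 𝓘(ℝ, E) 𝓘(ℝ, E) (fun y : G => x * y) g
      (mfderiv 𝓘(ℝ, E) 𝓘(ℝ, E) (fun y : G => x * y) g) :=
  ((contMDiff_mul_left (I := 𝓘(ℝ, E)) (n := ∞) (a := x)).mdifferentiable (by simp) g).hasMFDerivAt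

theorem mulInvariantVectorField_mul (ξ : GroupLieAlgebra 𝓘(ℝ, E) G) (x g : G) :
    mulInvariantVectorField ξ (x * g) =
      mfderiv 𝓘(ℝ, E) 𝓘(ℝ, E) (fun y : G => x * y) g (mulInvariantVectorField ξ g) := by
  have h2 : HasMFDerivAt 𝓘(ℝ, E) 𝓘(ℝ, E) (fun y : G => x * y) (g * 1)
      (mfderiv 𝓘(ℝ, E) 𝓘(ℝ, E) (fun y : G => x * y) (g * 1)) := hasMFDerivAt_mul_left x _
  have h := (HasMFDerivAt.comp (1 : G) h2 (hasMFDerivAt_mul_left g 1)).mfderiv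
  have h3 : (fun y : G => x * y) ∘ (fun y : G => g * y) = fun y => x * g * y := by
    funext y; simp [mul_assoc]
  rw [h3] at h
  have h4 := DFunLike.congr_fun h ξ
  rw [mulInvariantVectorField, mulInvariantVectorField]
  refine h4.trans ?_
  change (mfderiv 𝓘(ℝ, E) 𝓘(ℝ, E) (fun y : G => x * y) (g * 1)) _ = _
  rw [mul_one]
  rfl

theorem IsMIntegralCurveOn.mul_left {γ : ℝ → G} {ξ : GroupLieAlgebra 𝓘(ℝ, E) G} {s : Set ℝ}
    (h : IsMIntegralCurveOn γ (mulInvariantVectorField ξ) s) (x : G) :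
    IsMIntegralCurveOn (fun t => x * γ t) (mulInvariantVectorField ξ) s := by
  intro t ht
  have h1 := HasMFDerivAt.comp_hasMFDerivWithinAt t (hasMFDerivAt_mul_left x (γ t)) (h t ht)
  refine h1.congr_mfderiv (ContinuousLinearMap.ext_ring ?_)
  change mfderiv 𝓘(ℝ, E) 𝓘(ℝ, E) (fun y : G => x * y) (γ t)
    ((1 : ℝ) • mulInvariantVectorField ξ (γ t)) = (1 : ℝ) • mulInvariantVectorField ξ (x * γ t)
  rw [one_smul, one_smul, mulInvariantVectorField_mul]

theorem IsMIntegralCurve.mul_left {γ : ℝ → G} {ξ : GroupLieAlgebra 𝓘(ℝ, E) G}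
    (h : IsMIntegralCurve γ (mulInvariantVectorField ξ)) (x : G) :
    IsMIntegralCurve (fun t => x * γ t) (mulInvariantVectorField ξ) := by
  rw [isMIntegralCurve_iff_isMIntegralCurveOn] at h ⊢
  exact IsMIntegralCurveOn.mul_left h x

theorem contMDiff_mulInvariantVectorField_one (ξ : GroupLieAlgebra 𝓘(ℝ, E) G) :
    ContMDiff 𝓘(ℝ, E) 𝓘(ℝ, E).tangent 1
      (fun g : G => (⟨g, mulInvariantVectorField ξ g⟩ : TangentBundle 𝓘(ℝ, E) G)) :=
  (contMDiff_mulInvariantVectorField ξ).of_le (by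
    rw [minSmoothness_of_isRCLikeNormedField]; exact one_le_two)

theorem IsOneParameterSubgroup.isMIntegralCurve {γ : ℝ → G} {ξ : E}
    (h : IsOneParameterSubgroup 𝓘(ℝ, E) γ ξ) :
    IsMIntegralCurve γ (mulInvariantVectorField (I := 𝓘(ℝ, E)) (G := G) ξ) := by
  intro t
  -- The point is a variable, since the type of the derivative depends on it.
  have h0 : ∀ r : ℝ, r = 0 → HasMFDerivAt 𝓘(ℝ, ℝ) 𝓘(ℝ, E) γ r
      ((1 : ℝ →L[ℝ] ℝ).smulRight ξ : ℝ →L[ℝ] E) := by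
    rintro _ rfl
    exact h.hasMFDerivAt_zero
  have h1 : HasMFDerivAt 𝓘(ℝ, ℝ) 𝓘(ℝ, ℝ) (fun s : ℝ => s - t) t (ContinuousLinearMap.id ℝ ℝ) :=
    ((hasFDerivAt_id t).sub_const t).hasMFDerivAt
  have h2 := HasMFDerivAt.comp t (hasMFDerivAt_mul_left (γ t) (γ (t - t)))
    (HasMFDerivAt.comp (f := fun s : ℝ => s - t) t (h0 (t - t) (sub_self t)) h1)
  have h3 : (fun y => γ t * y) ∘ γ ∘ (fun s : ℝ => s - t) = γ := by
    funext s
    simp [← h.1]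
  rw [h3] at h2
  have h4 : γ t * γ (t - t) = γ t := by simp [← h.1]
  refine HasMFDerivAt.congr_mfderiv (f' := ?_) ?_ (ContinuousLinearMap.ext_ring ?_)
  · exact ((show E →L[ℝ] E from mfderiv 𝓘(ℝ, E) 𝓘(ℝ, E) (fun y : G => γ t * y) (γ (t - t))).comp
      ((1 : ℝ →L[ℝ] ℝ).smulRight ξ) : ℝ →L[ℝ] E)
  · exact h2
  · change mfderiv 𝓘(ℝ, E) 𝓘(ℝ, E) (fun y : G => γ t * y) (γ (t - t)) ((1 : ℝ) • ξ) =
      (1 : ℝ) • mulInvariantVectorField (I := 𝓘(ℝ, E)) (G := G) ξ (γ t)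
    rw [one_smul, one_smul, sub_self, h.map_zero]
    rfl

/-- In the chart at the identity, a curve with constant logarithmic derivative solves a smooth
autonomous differential equation, so it is as smooth as one likes. -/
theorem contMDiffAt_of_hasLogDerivAt_const [CompleteSpace E] {γ : ℝ → G} {ξ : E} (h0 : γ 0 = 1)
    (h : ∀ t, HasLogDerivAt γ ((1 : ℝ →L[ℝ] ℝ).smulRight ξ) t) (n : ℕ) :
    ContMDiffAt 𝓘(ℝ, ℝ) 𝓘(ℝ, E) n γ 0 := by
  set y : ℝ → E := fun t => unitChart E G (γ t) with hy
  have hc : ContinuousAt γ 0 := (h 0).1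
  have ht : Tendsto γ (𝓝 0) (𝓝 1) := h0 ▸ hc.tendsto
  obtain ⟨u, hu, hAu⟩ := ((contDiffAt_chartRight (E := E) (G := G)).of_le
    (m := n) (by exact_mod_cast le_top)).contDiffOn le_rfl (by simp)
  obtain ⟨δ, hδ, hδu⟩ := Metric.nhds_basis_closedBall.eventually_iff.1
    (((Eventually.of_forall h).and (ht.eventually (unitDomain_mem_nhds (E := E) (G := G)))).and
      ((ht.eventually (continuousAt_unitChart (E := E) (G := G) |>.eventually hu))))
  have hIcc : ∀ t ∈ Set.Icc (-δ) δ, t ∈ Metric.closedBall (0 : ℝ) δ := by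
    intro t ht
    rwa [Real.closedBall_eq_Icc, zero_sub, zero_add]
  have hyn : ContDiffOn ℝ n y (Set.Icc (-δ) δ) := by
    refine ODE.contDiffOn_enat_Icc_of_hasDerivWithinAt (n := n) (u := u)
      (f := fun _ a => chartRight E G a ξ) ?_ ?_ ?_
    · exact (hAu.comp contDiff_snd.contDiffOn fun p hp => hp.2).clm_apply contDiffOn_const
    · intro t ht
      have h1 := (hδu (hIcc t ht)).1
      have h2 := (h1.1.hasFDerivAt_unitChart h1.2).hasDerivAt
      simpa using h2.hasDerivWithinAt
    · exact fun t ht => (hδu (hIcc t ht)).2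
  have hyn0 : ContDiffAt ℝ n y 0 := hyn.contDiffAt (Icc_mem_nhds (by linarith) hδ)
  have h2 : ContMDiffAt 𝓘(ℝ, ℝ) 𝓘(ℝ, E) n (fun t => (unitChart E G).symm (y t)) 0 :=
    ContMDiffAt.comp_of_eq (y := unitCoord E G)
      ((contMDiffAt_unitChart_symm (E := E) (G := G)).of_le (by exact_mod_cast le_top))
      hyn0.contMDiffAt (by simp [hy, h0])
  refine h2.congr_of_eventuallyEq ?_
  filter_upwards [ht.eventually (eventually_unitChart_left_inv (E := E) (G := G))] with t ht
  exact ht.symm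

variable [T2Space G]

theorem IsOneParameterSubgroup.unique {γ γ' : ℝ → G} {ξ : E}
    (h : IsOneParameterSubgroup 𝓘(ℝ, E) γ ξ) (h' : IsOneParameterSubgroup 𝓘(ℝ, E) γ' ξ) :
    γ = γ' := by
  have : IsManifold 𝓘(ℝ, E) ∞ G := ContMDiffMul.toIsManifold
  have : IsManifold 𝓘(ℝ, E) 1 G := IsManifold.of_le (n := ∞) (by simp)
  exact isMIntegralCurve_Ioo_eq_of_contMDiff_boundaryless (t₀ := 0)
    (contMDiff_mulInvariantVectorField_one ξ) h.isMIntegralCurve h'.isMIntegralCurve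
    (by rw [h.map_zero, h'.map_zero])

theorem IsOneParameterSubgroup.lieExp_eq {γ : ℝ → G} {ξ : E}
    (h : IsOneParameterSubgroup 𝓘(ℝ, E) γ ξ) : lieExp 𝓘(ℝ, E) G ξ = γ 1 := by
  have h1 : ∃ γ : ℝ → G, IsOneParameterSubgroup 𝓘(ℝ, E) γ ξ := ⟨γ, h⟩
  rw [lieExp, dif_pos h1, h1.choose_spec.unique h]

variable [FiniteDimensional ℝ E]

variable (G) in
/-- Left-invariant fields are complete, because a local integral curve through the identity can be
translated to any point. The integral curve through the identity is a one-parameter subgroup. -/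
theorem exists_isOneParameterSubgroup (ξ : E) :
    ∃ γ : ℝ → G, IsOneParameterSubgroup 𝓘(ℝ, E) γ ξ := by
  have : IsManifold 𝓘(ℝ, E) ∞ G := ContMDiffMul.toIsManifold
  have : IsManifold 𝓘(ℝ, E) 1 G := IsManifold.of_le (n := ∞) (by simp)
  have : CompleteSpace E := FiniteDimensional.complete ℝ E
  have hV := contMDiff_mulInvariantVectorField_one (E := E) (G := G) ξ
  obtain ⟨γ₀, hγ₀, hγ₀'⟩ := exists_isMIntegralCurveAt_of_contMDiffAt_boundaryless (t₀ := 0)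
    (hV.contMDiffAt (x := 1))
  obtain ⟨ε, hε, hγε⟩ := isMIntegralCurveAt_iff'.1 hγ₀'
  obtain ⟨γ, hγ, hγ'⟩ := exists_isMIntegralCurve_of_isMIntegralCurveOn hV hε
    (fun x => ⟨fun t => x * γ₀ t, by simp [hγ₀], by
      rw [Real.ball_eq_Ioo, zero_sub, zero_add] at hγε
      exact IsMIntegralCurveOn.mul_left hγε x⟩) 1
  have hadd : ∀ s t, γ (s + t) = γ s * γ t := by
    intro s t
    have h1 := hγ'.comp_add s
    have h2 := isMIntegralCurve_Ioo_eq_of_contMDiff_boundaryless (t₀ := 0) hV h1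
      (IsMIntegralCurve.mul_left hγ' (γ s)) (by simp [hγ])
    simpa [add_comm] using congrFun h2 t
  have hd0 : HasMFDerivAt 𝓘(ℝ, ℝ) 𝓘(ℝ, E) γ 0 ((1 : ℝ →L[ℝ] ℝ).smulRight ξ : ℝ →L[ℝ] E) := by
    have h1 := hγ' 0
    have h2 : (show E from mulInvariantVectorField (I := 𝓘(ℝ, E)) (G := G) ξ (γ 0)) = ξ := by
      rw [hγ]
      exact mulInvariantVectorField_one _
    have h3 : ((1 : ℝ →L[ℝ] ℝ).smulRight (show E from
        mulInvariantVectorField (I := 𝓘(ℝ, E)) (G := G) ξ (γ 0)) : ℝ →L[ℝ] E) =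
        (1 : ℝ →L[ℝ] ℝ).smulRight ξ := by rw [h2]
    rw [← h3]
    exact h1
  have hlog := hasLogDerivAt_of_map_add hadd hγ
    (continuous_iff_continuousAt.2 fun t => (hγ' t).continuousAt) hd0
  refine ⟨γ, hadd, ?_, ?_⟩
  · rw [contMDiff_infty]
    intro n t
    have h0 := contMDiffAt_of_hasLogDerivAt_const hγ hlog n
    have h1 : ContMDiffAt 𝓘(ℝ, ℝ) 𝓘(ℝ, E) n (fun s => γ (s - t)) t :=
      ContMDiffAt.comp_of_eq (y := 0) h0
        (contDiff_id.sub contDiff_const).contMDiff.contMDiffAt (by simp)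
    have h2 := ContMDiffAt.comp t ((contMDiff_mul_left (I := 𝓘(ℝ, E)) (n := ∞)
      (a := γ t)).contMDiffAt.of_le (m := n) (by exact_mod_cast le_top)) h1
    have h3 : (fun y => γ t * y) ∘ (fun s : ℝ => γ (s - t)) = γ := by
      funext s
      simp [← hadd]
    rwa [h3] at h2
  · have h1 : (show ℝ →L[ℝ] E from mfderiv 𝓘(ℝ, ℝ) 𝓘(ℝ, E) γ 0) =
      (1 : ℝ →L[ℝ] ℝ).smulRight ξ := hd0.mfderiv
    have h2 := DFunLike.congr_fun h1 (1 : ℝ)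
    simpa using! h2

variable (G) in
theorem isOneParameterSubgroup_lieExp (ξ : E) :
    IsOneParameterSubgroup 𝓘(ℝ, E) (fun t : ℝ => lieExp 𝓘(ℝ, E) G (t • ξ)) ξ := by
  obtain ⟨γ, h⟩ := exists_isOneParameterSubgroup G ξ
  have : (fun t : ℝ => lieExp 𝓘(ℝ, E) G (t • ξ)) = γ := by
    funext t
    rw [(h.comp_mul t).lieExp_eq, mul_one]
  rwa [this]

variable (G) in
theorem lieExp_zero : lieExp 𝓘(ℝ, E) G (0 : E) = 1 := by
  simpa using (isOneParameterSubgroup_lieExp G (0 : E)).map_zero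

variable (G) in
theorem lieExp_neg (ξ : E) : lieExp 𝓘(ℝ, E) G (-ξ) = (lieExp 𝓘(ℝ, E) G ξ)⁻¹ := by
  have h := (isOneParameterSubgroup_lieExp G ξ).1 (-1) 1
  simp only [neg_add_cancel, zero_smul, neg_smul, one_smul, lieExp_zero] at h
  exact eq_inv_of_mul_eq_one_left h.symm

variable (G) in
theorem hasLogDerivAt_lieExp_smul (ξ : E) (t : ℝ) :
    HasLogDerivAt (fun t : ℝ => lieExp 𝓘(ℝ, E) G (t • ξ)) ((1 : ℝ →L[ℝ] ℝ).smulRight ξ) t :=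
  (isOneParameterSubgroup_lieExp G ξ).hasLogDerivAt t

end OneParameter

/-! ### The entire function `(exp x - 1) / x` -/

section ExpDiv

variable {A : Type*} [NormedRing A] [NormedAlgebra ℝ A]

/-- The entire function `(exp x - 1) / x = ∑ₖ x ^ k / (k + 1)!` on a Banach algebra. -/
def expDiv (x : A) : A := ∑' k : ℕ, ((Nat.factorial (k + 1) : ℝ)⁻¹) • x ^ k

theorem expDiv_zero : expDiv (0 : A) = 1 := by
  rw [expDiv, tsum_eq_single 0]
  · simp
  · intro k hk
    simp [hk]

variable [CompleteSpace A]

theorem contDiff_expDiv {n : WithTop ℕ∞} : ContDiff ℝ n (expDiv : A → A) := by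
  set c : ℕ → ℝ := fun k => (Nat.factorial (k + 1) : ℝ)⁻¹ with hc
  have hc0 : ∀ n, c n ≠ 0 := fun n => inv_ne_zero (Nat.cast_ne_zero.2 (Nat.factorial_ne_zero _))
  have hrad : (FormalMultilinearSeries.ofScalars A c).radius = ⊤ := by
    refine FormalMultilinearSeries.ofScalars_radius_eq_top_of_tendsto A c
      (Eventually.of_forall hc0) ?_
    have h1 : ∀ k : ℕ, ‖c k.succ‖ / ‖c k‖ = 1 / ((k : ℝ) + 2) := by
      intro k
      have h2 : (Nat.factorial (k + 1) : ℝ) ≠ 0 := Nat.cast_ne_zero.2 (Nat.factorial_ne_zero _)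
      simp only [hc, norm_inv, RCLike.norm_natCast, Nat.succ_eq_add_one]
      rw [Nat.factorial_succ (k + 1)]
      push_cast
      field_simp
      ring
    simp_rw [h1]
    have h3 := (tendsto_one_div_add_atTop_nhds_zero_nat (𝕜 := ℝ)).comp (tendsto_add_atTop_nat 1)
    refine h3.congr fun k => ?_
    simp only [comp_apply]
    push_cast
    ring
  have h1 := (FormalMultilinearSeries.ofScalars A c).hasFPowerSeriesOnBall (by rw [hrad]; simp)
  rw [hrad] at h1
  have h2 : (FormalMultilinearSeries.ofScalars A c).sum = expDiv :=
    FormalMultilinearSeries.ofScalarsSum_eq_tsum c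
  rw [h2] at h1
  exact contDiff_iff_contDiffAt.2 fun x => (h1.analyticOnNhd x (by simp)).contDiffAt

/-- `t ↦ t • expDiv (t • x)` is the primitive of `t ↦ exp (t • x)` vanishing at `0`. -/
theorem hasDerivAt_smul_expDiv (x : A) (t : ℝ) :
    HasDerivAt (fun t : ℝ => t • expDiv (t • x)) (NormedSpace.exp (t • x)) t := by
  set R : ℝ := |t| + 1 with hR
  have hf : ∀ (k : ℕ), ((k + 1).factorial : ℝ)⁻¹ * (k + 1) = (k.factorial : ℝ)⁻¹ := by
    intro k
    have h2 : (Nat.factorial k : ℝ) ≠ 0 := Nat.cast_ne_zero.2 (Nat.factorial_ne_zero _)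
    rw [Nat.factorial_succ]
    push_cast
    field_simp
  have hgd : ∀ (k : ℕ) (s : ℝ), HasDerivAt
      (fun s : ℝ => (((k + 1).factorial : ℝ)⁻¹ * s ^ (k + 1)) • x ^ k)
      (((k.factorial : ℝ)⁻¹ * s ^ k) • x ^ k) s := by
    intro k s
    have h := ((hasDerivAt_pow (k + 1) s).const_mul ((k + 1).factorial : ℝ)⁻¹).smul_const (x ^ k)
    refine h.congr_deriv ?_
    rw [← hf k]
    push_cast
    simp [mul_assoc]
  have hsum : Summable fun k : ℕ => ‖((k.factorial : ℝ)⁻¹) • (R • x) ^ k‖ :=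
    NormedSpace.norm_expSeries_summable' (𝕂 := ℝ) (R • x)
  have h := hasDerivAt_tsum_of_isPreconnected (t := Metric.ball (0 : ℝ) R) (y₀ := 0) (y := t)
    hsum Metric.isOpen_ball (convex_ball _ _).isPreconnected (fun k s _ => hgd k s)
    (fun k s hs => ?_) (by simp [hR]; positivity)
    (by simp) (by simp [hR])
  · have h1 : (fun z : ℝ => ∑' k : ℕ, (((k + 1).factorial : ℝ)⁻¹ * z ^ (k + 1)) • x ^ k) =
        fun t : ℝ => t • expDiv (t • x) := by
      funext z
      rw [expDiv, ← tsum_const_smul'']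
      refine tsum_congr fun k => ?_
      rw [smul_pow, smul_smul, smul_smul, pow_succ]
      ring_nf
    have h2 : ∑' k : ℕ, ((k.factorial : ℝ)⁻¹ * t ^ k) • x ^ k = NormedSpace.exp (t • x) := by
      rw [NormedSpace.exp_eq_tsum ℝ]
      refine tsum_congr fun k => ?_
      rw [smul_pow, smul_smul]
    rwa [h1, h2] at h
  · have hs' : |s| ≤ R := by simpa using (Metric.mem_ball.1 hs).le
    have hR0 : 0 ≤ R := by positivity
    rw [smul_pow, smul_smul, norm_smul, norm_smul, norm_mul, norm_mul, norm_pow s, norm_pow R,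
      Real.norm_eq_abs s, Real.norm_eq_abs R, abs_of_nonneg hR0]
    gcongr

theorem exp_smul_mul_exp_smul (x : A) (s t : ℝ) :
    NormedSpace.exp (s • x) * NormedSpace.exp (t • x) = NormedSpace.exp ((s + t) • x) := by
  let _ : NormedAlgebra ℚ A := NormedAlgebra.restrictScalars ℚ ℝ A
  rw [add_smul, NormedSpace.exp_add_of_commute]
  exact ((Commute.refl x).smul_left s).smul_right t

theorem exp_neg_mul_exp (x : A) : NormedSpace.exp (-x) * NormedSpace.exp x = 1 := by
  have h := exp_smul_mul_exp_smul x (-1) 1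
  simpa using h

theorem exp_neg_mul_expDiv (x : A) : NormedSpace.exp (-x) * expDiv x = expDiv (-x) := by
  -- Both sides are the value at `0` of a primitive of `-exp ((t - 1) • x)` vanishing at `1`.
  have h1 : ∀ t : ℝ, HasDerivAt (fun t : ℝ => NormedSpace.exp (-x) * (t • expDiv (t • x)) +
      (1 - t) • expDiv ((1 - t) • (-x))) 0 t := by
    intro t
    have h2 := (hasDerivAt_smul_expDiv x t).const_mul (NormedSpace.exp (-x))
    have h3 : HasDerivAt (fun t : ℝ => 1 - t) (-1) t := by
      simpa using (hasDerivAt_id t).const_sub 1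
    have h4 := HasDerivAt.scomp t (hasDerivAt_smul_expDiv (-x) (1 - t)) h3
    refine (h2.add h4).congr_deriv ?_
    have h5 := exp_smul_mul_exp_smul x (-1) t
    rw [neg_one_smul] at h5
    rw [h5, smul_neg, ← neg_smul, neg_one_smul, show -(1 - t) = -1 + t by ring, add_neg_cancel]
  have h6 := is_const_of_deriv_eq_zero (fun t => (h1 t).differentiableAt)
    (fun t => (h1 t).deriv) 1 0
  simpa using h6

/-- Companion of `exp_neg_mul_expDiv`, with the same proof. -/
theorem expDiv_mul_exp_neg (x : A) : expDiv x * NormedSpace.exp (-x) = expDiv (-x) := by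
  have h1 : ∀ t : ℝ, HasDerivAt (fun t : ℝ => (t • expDiv (t • x)) * NormedSpace.exp (-x) +
      (1 - t) • expDiv ((1 - t) • (-x))) 0 t := by
    intro t
    have h2 := (hasDerivAt_smul_expDiv x t).mul_const (NormedSpace.exp (-x))
    have h3 : HasDerivAt (fun t : ℝ => 1 - t) (-1) t := by
      simpa using (hasDerivAt_id t).const_sub 1
    have h4 := HasDerivAt.scomp t (hasDerivAt_smul_expDiv (-x) (1 - t)) h3
    refine (h2.add h4).congr_deriv ?_
    have h5 := exp_smul_mul_exp_smul x t (-1)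
    rw [neg_one_smul] at h5
    rw [h5, smul_neg, ← neg_smul, neg_one_smul, show -(1 - t) = t + -1 by ring, add_neg_cancel]
  have h6 := is_const_of_deriv_eq_zero (fun t => (h1 t).differentiableAt)
    (fun t => (h1 t).deriv) 1 0
  simpa using h6

theorem exp_mul_expDiv_neg (x : A) : NormedSpace.exp x * expDiv (-x) = expDiv x := by
  simpa using exp_neg_mul_expDiv (-x)

end ExpDiv

/-! ### The adjoint representation and the exponential map -/

section AdExp

variable {E : Type*} [NormedAddCommGroup E] [NormedSpace ℝ E]
variable (G : Type*) [TopologicalSpace G] [ChartedSpace E G] [Group G]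
  [LieGroup 𝓘(ℝ, E) ∞ G]

theorem hasFDerivAt_chartAd :
    HasFDerivAt (chartAd E G) (fderiv ℝ (chartAd E G) (unitCoord E G)) (unitCoord E G) :=
  ((contDiffAt_chartAd (E := E) (G := G)).differentiableAt (by simp)).hasFDerivAt

variable [FiniteDimensional ℝ E]

theorem fderiv_chartAd_eq_ad (v : E) :
    fderiv ℝ (chartAd E G) (unitCoord E G) v = ad G v := by
  ext w
  rw [fderiv_chartAd, ad_apply]

theorem ad_smul (t : ℝ) (ξ : E) : ad G (t • ξ) = t • ad G ξ := by
  ext w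
  exact congrArg (fun L : E →ₗ[ℝ] E => L w)
    ((LieAlgebra.ad ℝ (GroupLieAlgebra 𝓘(ℝ, E) G)).map_smul t ξ)

theorem ad_neg (ξ : E) : ad G (-ξ) = -ad G ξ := by
  simpa using ad_smul G (-1) ξ

/-- `ad` as a continuous linear map. -/
def adCLM : E →L[ℝ] E →L[ℝ] E :=
  LinearMap.toContinuousLinearMap
    { toFun := ad G
      map_add' := fun ξ η => by
        ext w
        exact congrArg (fun L : E →ₗ[ℝ] E => L w)
          ((LieAlgebra.ad ℝ (GroupLieAlgebra 𝓘(ℝ, E) G)).map_add ξ η)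
      map_smul' := ad_smul G }

theorem adCLM_apply (ξ : E) : adCLM G ξ = ad G ξ := rfl

theorem contDiff_ad {n : WithTop ℕ∞} : ContDiff ℝ n (ad G : E → E →L[ℝ] E) :=
  ContinuousLinearMap.contDiff (𝕜 := ℝ) (adCLM G : E →L[ℝ] E →L[ℝ] E)

theorem dexp_eq (ξ : E) : dexp G ξ = expDiv (ad G ξ) := rfl

theorem contDiff_dexp {n : WithTop ℕ∞} : ContDiff ℝ n (dexp G : E → E →L[ℝ] E) :=
  contDiff_expDiv.comp (contDiff_ad G)

theorem dexp_zero : dexp G (0 : E) = ContinuousLinearMap.id ℝ E := by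
  have h : ad G (0 : E) = 0 := by simpa using ad_smul G 0 (0 : E)
  rw [dexp_eq, h]
  exact expDiv_zero

variable [T2Space G]

/-- The infinitesimal version of `Ad_{exp ξ} = exp (ad_ξ)`. -/
theorem hasDerivAt_Ad_lieExp_zero (ξ : E) :
    HasDerivAt (fun t : ℝ => Ad (E := E) (lieExp 𝓘(ℝ, E) G (t • ξ))) (ad G ξ) 0 := by
  have h := hasLogDerivAt_lieExp_smul G ξ 0
  have h1 : HasFDerivAt (fun t : ℝ => unitChart E G (lieExp 𝓘(ℝ, E) G (t • ξ)))
      ((1 : ℝ →L[ℝ] ℝ).smulRight ξ) 0 := by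
    simpa [lieExp_zero] using h.2
  have h2 := (HasFDerivAt.comp (f := fun t : ℝ => unitChart E G (lieExp 𝓘(ℝ, E) G (t • ξ)))
    (0 : ℝ) (by simpa [lieExp_zero] using hasFDerivAt_chartAd G) h1).hasDerivAt
  have h3 : Tendsto (fun t : ℝ => lieExp 𝓘(ℝ, E) G (t • ξ)) (𝓝 0) (𝓝 1) := by
    simpa [lieExp_zero] using h.1.tendsto
  refine (h2.congr_deriv ?_).congr_of_eventuallyEq ?_
  · simpa using fderiv_chartAd_eq_ad G ξ
  · filter_upwards [h3.eventually (eventually_unitChart_left_inv (E := E) (G := G))] with t ht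
    simp only [comp_apply, chartAd, ht]

/-- `Ad_{exp ξ} = exp (ad_ξ)`. -/
theorem Ad_lieExp (ξ : E) :
    Ad (E := E) (lieExp 𝓘(ℝ, E) G ξ) = NormedSpace.exp (ad G ξ) := by
  set B : ℝ → E →L[ℝ] E := fun t => Ad (E := E) (lieExp 𝓘(ℝ, E) G (t • ξ)) with hB
  have hadd : ∀ s t, B (s + t) = B s * B t := by
    intro s t
    have h := (isOneParameterSubgroup_lieExp G ξ).1 s t
    simp only [hB, h, Ad_mul]
    rfl
  have hd : ∀ t, HasDerivAt B (B t * ad G ξ) t := by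
    intro t
    have h1 : HasDerivAt (fun s : ℝ => s - t) 1 t := (hasDerivAt_id t).sub_const t
    have h2 := HasDerivAt.scomp t (h := fun s : ℝ => s - t)
      (by simpa using hasDerivAt_Ad_lieExp_zero G ξ) h1
    rw [one_smul] at h2
    refine (h2.const_mul (B t)).congr_of_eventuallyEq (Eventually.of_forall fun s => ?_)
    simp only [comp_apply]
    change B s = B t * B (s - t)
    rw [← hadd, add_sub_cancel]
  -- `B t` and `exp (t • ad ξ)` solve the same linear equation: their quotient is constant.
  have hc : ∀ t, HasDerivAt (fun t : ℝ => B t * NormedSpace.exp (t • (-ad G ξ))) 0 t := by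
    intro t
    refine ((hd t).mul (hasDerivAt_exp_smul_const' (𝕂 := ℝ) (-ad G ξ) t)).congr_deriv ?_
    noncomm_ring
  have h6 := is_const_of_deriv_eq_zero (fun t => (hc t).differentiableAt)
    (fun t => (hc t).deriv) 1 0
  have hB0 : B 0 = 1 := by
    simp only [hB, zero_smul, lieExp_zero, Ad_one]
    rfl
  simp only [one_smul, zero_smul, NormedSpace.exp_zero, hB0, mul_one] at h6
  have h7 : B 1 = NormedSpace.exp (ad G ξ) := by
    calc B 1 = B 1 * (NormedSpace.exp (-ad G ξ) * NormedSpace.exp (ad G ξ)) := by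
          rw [exp_neg_mul_exp, mul_one]
      _ = _ := by rw [← mul_assoc, h6, one_mul]
  simpa [hB] using h7

theorem contDiff_Ad_lieExp {n : WithTop ℕ∞} :
    ContDiff ℝ n (fun ξ : E => Ad (E := E) (lieExp 𝓘(ℝ, E) G ξ)) := by
  simp only [Ad_lieExp]
  refine ContDiff.comp (g := NormedSpace.exp) ?_ (contDiff_ad G)
  exact contDiff_iff_contDiffAt.2 fun x => (NormedSpace.exp_analytic (𝕂 := ℝ) x).contDiffAt

theorem dexp_neg (ξ : E) :
    dexp G (-ξ) = (Ad (lieExp 𝓘(ℝ, E) G (-ξ))).comp (dexp G ξ) := by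
  rw [dexp_eq, dexp_eq, Ad_lieExp, ad_neg]
  exact (exp_neg_mul_expDiv _).symm

theorem dexp_eq_Ad_comp (ξ : E) :
    dexp G ξ = (Ad (lieExp 𝓘(ℝ, E) G ξ)).comp (dexp G (-ξ)) := by
  rw [dexp_eq, dexp_eq, Ad_lieExp, ad_neg]
  exact (exp_mul_expDiv_neg _).symm

theorem dexp_neg_eq_comp_Ad (ξ : E) :
    dexp G (-ξ) = (dexp G ξ).comp (Ad (lieExp 𝓘(ℝ, E) G (-ξ))) := by
  rw [dexp_eq, dexp_eq, Ad_lieExp, ad_neg]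
  exact (expDiv_mul_exp_neg _).symm

end AdExp

/-! ### The derivative of the exponential map -/

section ExpDeriv

variable {E : Type*} [NormedAddCommGroup E] [NormedSpace ℝ E] [FiniteDimensional ℝ E]
variable {G : Type*} [TopologicalSpace G] [T2Space G] [ChartedSpace E G] [Group G]
  [LieGroup 𝓘(ℝ, E) ∞ G]

/-- A curve in `G` starting at the identity, whose velocity in the chart at the identity is bounded
by `C` as long as it stays in a ball of radius `r > C`, stays in that ball during a unit of time. -/
theorem norm_unitChart_sub_le_of_hasLogDerivAt {η : ℝ → G} {ζ : ℝ → E} {C r : ℝ} (hη0 : η 0 = 1)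
    (hη : ∀ t, HasLogDerivAt η ((1 : ℝ →L[ℝ] ℝ).smulRight (ζ t)) t)
    (hC : ∀ t ∈ Set.Icc (0 : ℝ) 1, ∀ b ∈ Metric.closedBall (unitCoord E G) r,
      ‖chartRight E G b (ζ t)‖ ≤ C) (hC0 : 0 ≤ C) (hCr : C < r)
    (htarget : Metric.closedBall (unitCoord E G) r ⊆ (unitChart E G).target)
    (hdom : ∀ b ∈ Metric.closedBall (unitCoord E G) r, (unitChart E G).symm b ∈ unitDomain E G)
    {t : ℝ} (ht : t ∈ Set.Icc (0 : ℝ) 1) :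
    η t ∈ (unitChart E G).source ∧ η t ∈ unitDomain E G ∧
      ‖unitChart E G (η t) - unitCoord E G‖ ≤ C * t := by
  have hr0 : 0 < r := hC0.trans_lt hCr
  set φ := unitChart E G with hφ
  set e := unitCoord E G with he
  have : ProperSpace E := FiniteDimensional.proper_real E
  -- `V` is compact, hence closed in the Hausdorff group `G`; so the times which the curve spends
  -- in `V` form a closed set.
  set V : Set G := φ.symm '' Metric.closedBall e r with hV
  have hVc : IsClosed V :=
    ((isCompact_closedBall e r).image_of_continuousOn
      ((continuousOn_extChartAt_symm (I := 𝓘(ℝ, E)) (1 : G)).mono htarget)).isClosed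
  have hVs : ∀ g ∈ V, g ∈ φ.source ∧ φ g ∈ Metric.closedBall e r ∧ g ∈ unitDomain E G := by
    rintro _ ⟨b, hb, rfl⟩
    exact ⟨φ.map_target (htarget hb), by rwa [φ.right_inv (htarget hb)], hdom b hb⟩
  have hVmem : ∀ g ∈ φ.source, φ g ∈ Metric.closedBall e r → g ∈ V := fun g hg hgb =>
    ⟨φ g, hgb, φ.left_inv hg⟩
  have hηc : Continuous η := continuous_iff_continuousAt.2 fun t => (hη t).1
  set s : Set ℝ := {t | η t ∈ V ∧ ‖φ (η t) - e‖ ≤ C * t} with hs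
  -- Continuous induction: `s` is closed, contains `0` and extends to the right of its points.
  suffices h : Set.Icc (0 : ℝ) 1 ⊆ s from
    ⟨(hVs _ (h ht).1).1, (hVs _ (h ht).1).2.2, (h ht).2⟩
  refine IsClosed.Icc_subset_of_forall_exists_gt ?_ ?_ ?_
  · have hF : IsClosed (η ⁻¹' V ∩ Set.Icc 0 1) := (hVc.preimage hηc).inter isClosed_Icc
    have hcont : ContinuousOn (fun t => ‖φ (η t) - e‖ - C * t) (η ⁻¹' V ∩ Set.Icc 0 1) := by
      refine ContinuousOn.sub (ContinuousOn.norm (ContinuousOn.sub ?_ continuousOn_const))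
        (by fun_prop)
      exact (continuousOn_extChartAt (I := 𝓘(ℝ, E)) (1 : G)).comp hηc.continuousOn
        fun t ht => (hVs _ ht.1).1
    have h1 := hcont.preimage_isClosed_of_isClosed hF (isClosed_Iic (a := (0 : ℝ)))
    have h2 : s ∩ Set.Icc 0 1 = (η ⁻¹' V ∩ Set.Icc 0 1) ∩
        (fun t => ‖φ (η t) - e‖ - C * t) ⁻¹' Set.Iic 0 := by
      ext t
      simp only [hs, Set.mem_inter_iff, Set.mem_ofPred_eq, Set.mem_preimage, Set.mem_Iic,
        sub_nonpos]
      tauto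
    rwa [h2]
  · refine ⟨hVmem _ ?_ ?_, ?_⟩
    · rw [hη0]; exact mem_extChartAt_source (I := 𝓘(ℝ, E)) (1 : G)
    · rw [hη0]; exact Metric.mem_closedBall_self hr0.le
    · rw [hη0]; simp [he, hφ]
  · rintro x ⟨⟨hxV, hxC⟩, hx0, hx1⟩ y hy
    have hxr : ‖φ (η x) - e‖ < r := by nlinarith
    have hev : ∀ᶠ t in 𝓝 x, η t ∈ φ.source ∧ φ (η t) ∈ Metric.ball e r := by
      have h1 : ∀ᶠ g in 𝓝 (η x), g ∈ φ.source ∧ φ g ∈ Metric.ball e r := by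
        refine Filter.Eventually.and
          ((isOpen_extChartAt_source (I := 𝓘(ℝ, E)) (1 : G)).mem_nhds (hVs _ hxV).1) ?_
        refine (continuousAt_extChartAt' (I := 𝓘(ℝ, E)) (x := (1 : G)) (hVs _ hxV).1).eventually
          (Metric.isOpen_ball.mem_nhds ?_)
        rwa [mem_ball_iff_norm]
      exact (hηc.tendsto x).eventually h1
    obtain ⟨δ, hδ, hδb⟩ := Metric.eventually_nhds_iff_ball.1 hev
    set x' := min (min y 1) (x + δ / 2) with hx'
    have hxx' : x < x' := by
      simp only [hx', lt_min_iff]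
      exact ⟨⟨hy, hx1⟩, by linarith⟩
    have hx'1 : x' ≤ 1 := (min_le_left _ _).trans (min_le_right _ _)
    have hx'δ : x' ≤ x + δ / 2 := min_le_right _ _
    have hin : ∀ t ∈ Set.Icc x x', η t ∈ φ.source ∧ φ (η t) ∈ Metric.ball e r := by
      intro t ht
      refine hδb t ?_
      rw [Real.ball_eq_Ioo]
      constructor <;> linarith [ht.1, ht.2]
    have hmv := Convex.norm_image_sub_le_of_norm_hasDerivWithin_le (C := C)
      (f := fun t => φ (η t)) (f' := fun t => chartRight E G (φ (η t)) (ζ t))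
      (s := Set.Icc x x') (x := x) (y := x') ?_ ?_ (convex_Icc _ _)
      (Set.left_mem_Icc.2 hxx'.le) (Set.right_mem_Icc.2 hxx'.le)
    · refine ⟨x', ⟨?_, ?_⟩, hxx', (min_le_left _ _).trans (min_le_left _ _)⟩
      · have := hin x' (Set.right_mem_Icc.2 hxx'.le)
        exact hVmem _ this.1 (Metric.ball_subset_closedBall this.2)
      · have h1 : φ (η x') - e = (φ (η x') - φ (η x)) + (φ (η x) - e) := by abel
        rw [h1]
        refine (norm_add_le _ _).trans ?_
        rw [Real.norm_eq_abs, abs_of_pos (sub_pos.2 hxx')] at hmv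
        nlinarith
    · intro t ht
      have h1 := hin t ht
      have h2 := (hVs _ (hVmem _ h1.1 (Metric.ball_subset_closedBall h1.2))).2.2
      simpa using ((hη t).hasFDerivAt_unitChart h2).hasDerivAt.hasDerivWithinAt (s := Set.Icc x x')
    · intro t ht
      exact hC t ⟨hx0.trans ht.1, ht.2.trans hx'1⟩ _
        (Metric.ball_subset_closedBall (hin t ht).2)

variable (G) in
/-- `exp (t ξ)` commutes with `exp (s ξ)`; differentiate with respect to `s`. -/
theorem Ad_lieExp_smul_self (t : ℝ) (ξ : E) : Ad (lieExp 𝓘(ℝ, E) G (t • ξ)) ξ = ξ := by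
  have h1 := hasLogDerivAt_lieExp_smul G ξ t
  have h2 : HasLogDerivAt (fun s : ℝ => lieExp 𝓘(ℝ, E) G ((s + t) • ξ))
      ((1 : ℝ →L[ℝ] ℝ).smulRight ξ) 0 :=
    (HasLogDerivAt.comp (g := fun s : ℝ => lieExp 𝓘(ℝ, E) G (s • ξ)) (f := fun s => s + t)
      (by simpa using h1) ((hasFDerivAt_id (0 : ℝ)).add_const t)).congr_deriv (by ext; simp)
  have h3 := (hasLogDerivAt_lieExp_smul G ξ 0).const_mul (lieExp 𝓘(ℝ, E) G (t • ξ))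
  have h4 : (fun s : ℝ => lieExp 𝓘(ℝ, E) G ((s + t) • ξ)) =
      fun s : ℝ => lieExp 𝓘(ℝ, E) G (t • ξ) * lieExp 𝓘(ℝ, E) G (s • ξ) := by
    funext s
    rw [add_comm]
    exact (isOneParameterSubgroup_lieExp G ξ).1 t s
  rw [h4] at h2
  simpa using (DFunLike.congr_fun (h2.unique h3) (1 : ℝ)).symm

/-- The curve `t ↦ exp (-t ξ) exp (t (ξ + ζ))` has logarithmic derivative `Ad_{exp (-t ξ)} ζ`. -/
theorem hasLogDerivAt_lieExp_neg_mul_lieExp_add (ξ ζ : E) (t : ℝ) :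
    HasLogDerivAt (fun t : ℝ => lieExp 𝓘(ℝ, E) G (t • (-ξ)) * lieExp 𝓘(ℝ, E) G (t • (ξ + ζ)))
      ((1 : ℝ →L[ℝ] ℝ).smulRight (Ad (lieExp 𝓘(ℝ, E) G (t • (-ξ))) ζ)) t := by
  refine ((hasLogDerivAt_lieExp_smul G (-ξ) t).mul
    (hasLogDerivAt_lieExp_smul G (ξ + ζ) t)).congr_deriv ?_
  have h := Ad_lieExp_smul_self G t (-ξ)
  rw [map_neg, neg_inj] at h
  ext
  simp only [smul_neg] at h
  simp [h]

/-- The derivative of the exponential map, translated to the identity: comparing the curves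
`t ↦ exp (t ξ)` and `t ↦ exp (t (ξ + ζ))` leads to a differential equation whose solution is
`∫ Ad_{exp (-t ξ)} ζ dt = dexp_{-ξ} ζ` up to second order in `ζ`. -/
theorem hasLogDerivAt_lieExp_neg_mul (ξ : E) :
    HasLogDerivAt (fun ζ : E => lieExp 𝓘(ℝ, E) G (-ξ) * lieExp 𝓘(ℝ, E) G (ξ + ζ))
      (dexp G (-ξ)) 0 := by
  set φ := unitChart E G with hφ
  set e := unitCoord E G with he
  set k : E → G := fun ζ => lieExp 𝓘(ℝ, E) G (-ξ) * lieExp 𝓘(ℝ, E) G (ξ + ζ) with hk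
  have hk0 : k 0 = 1 := by simp [hk, lieExp_neg]
  obtain ⟨K, hK⟩ := isCompact_Icc.exists_bound_of_continuousOn (s := Set.Icc (0 : ℝ) 1)
    (f := fun t : ℝ => Ad (E := E) (lieExp 𝓘(ℝ, E) G (t • (-ξ))))
    (((contDiff_Ad_lieExp (n := 0) G).continuous.comp
      (continuous_id.smul continuous_const)).continuousOn)
  have hK0 : 0 ≤ K := (norm_nonneg _).trans (hK 0 (by simp))
  have hA := ((contDiffAt_chartRight (E := E) (G := G)).differentiableAt (by simp)).hasFDerivAt
  obtain ⟨L, hL0, hL⟩ := hA.isBigO_sub.exists_pos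
  have hL := hL.bound
  have hA2 : ∀ᶠ b in 𝓝 e, ‖chartRight E G b‖ < 2 := by
    refine hA.continuousAt.norm.eventually_lt continuousAt_const ?_
    rw [chartRight_unitCoord]
    exact (ContinuousLinearMap.norm_id_le).trans_lt one_lt_two
  obtain ⟨r, hr, hrb⟩ := Metric.nhds_basis_closedBall.eventually_iff.1
    ((hL.and hA2).and (Filter.Eventually.and
      (extChartAt_target_mem_nhds (I := 𝓘(ℝ, E)) (1 : G))
      ((tendsto_unitChart_symm (E := E) (G := G)).eventually
        (unitDomain_mem_nhds (E := E)))))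
  have hsmall : ∀ᶠ ζ in 𝓝 (0 : E), 2 * K * ‖ζ‖ < r := by
    have h1 : Tendsto (fun ζ : E => 2 * K * ‖ζ‖) (𝓝 0) (𝓝 (2 * K * ‖(0 : E)‖)) :=
      (continuous_const.mul continuous_norm).tendsto 0
    exact h1.eventually_lt_const (by simpa using hr)
  -- `K` bounds `Ad_{exp (-t ξ)}` for `t ∈ [0, 1]` and `L` is a Lipschitz constant of
  -- `chartRight` at the identity; `2` bounds the norm of `chartRight` on the ball of radius `r`.
  have hbound : ∀ ζ : E, 2 * K * ‖ζ‖ < r → k ζ ∈ φ.source ∧ ‖φ (k ζ) - e‖ ≤ 2 * K * ‖ζ‖ ∧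
      ‖φ (k ζ) - e - dexp G (-ξ) ζ‖ ≤ 2 * L * K * K * ‖ζ‖ ^ 2 := by
    intro ζ hζ
    have hnorm : ∀ t ∈ Set.Icc (0 : ℝ) 1, ‖Ad (lieExp 𝓘(ℝ, E) G (t • (-ξ))) ζ‖ ≤ K * ‖ζ‖ :=
      fun t ht => ContinuousLinearMap.le_of_opNorm_le _ (hK t ht) ζ
    have hη0 : lieExp 𝓘(ℝ, E) G ((0 : ℝ) • (-ξ)) * lieExp 𝓘(ℝ, E) G ((0 : ℝ) • (ξ + ζ)) = 1 := by
      simp [lieExp_zero]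
    have hmain := fun (t : ℝ) (ht : t ∈ Set.Icc (0 : ℝ) 1) =>
      norm_unitChart_sub_le_of_hasLogDerivAt
      (η := fun t : ℝ => lieExp 𝓘(ℝ, E) G (t • (-ξ)) * lieExp 𝓘(ℝ, E) G (t • (ξ + ζ)))
      (C := 2 * K * ‖ζ‖) (r := r) hη0
      (hasLogDerivAt_lieExp_neg_mul_lieExp_add ξ ζ) (fun t ht b hb => by
        refine (ContinuousLinearMap.le_of_opNorm_le _ (hrb hb).1.2.le _).trans ?_
        rw [mul_assoc]
        exact mul_le_mul_of_nonneg_left (hnorm t ht) (by norm_num)) (by positivity) hζ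
      (fun b hb => (hrb hb).2.1) (fun b hb => (hrb hb).2.2) ht
    have h1 := hmain 1 (by simp)
    simp only [one_smul, mul_one] at h1
    refine ⟨h1.1, h1.2.2, ?_⟩
    -- `t ↦ (t • expDiv (t • ad (-ξ))) ζ` is the primitive of `t ↦ Ad_{exp (-t ξ)} ζ`; its value at
    -- `1` is `dexp_{-ξ} ζ`.
    have hmv := Convex.norm_image_sub_le_of_norm_hasDerivWithin_le (C := 2 * L * K * K * ‖ζ‖ ^ 2)
      (f := fun t : ℝ => φ (lieExp 𝓘(ℝ, E) G (t • (-ξ)) * lieExp 𝓘(ℝ, E) G (t • (ξ + ζ))) -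
        (t • expDiv (t • ad G (-ξ))) ζ)
      (f' := fun t : ℝ => chartRight E G (φ (lieExp 𝓘(ℝ, E) G (t • (-ξ)) *
        lieExp 𝓘(ℝ, E) G (t • (ξ + ζ)))) (Ad (lieExp 𝓘(ℝ, E) G (t • (-ξ))) ζ) -
          Ad (lieExp 𝓘(ℝ, E) G (t • (-ξ))) ζ)
      (s := Set.Icc 0 1) (x := 0) (y := 1) ?_ ?_ (convex_Icc _ _) (by simp) (by simp)
    · simp only [one_smul, zero_smul, lieExp_zero, mul_one, sub_zero, norm_one] at hmv
      have h2 : φ (k ζ) - e - dexp G (-ξ) ζ =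
          φ (k ζ) - (expDiv (ad G (-ξ))) ζ - (φ 1 - (0 : E →L[ℝ] E) ζ) := by
        rw [dexp_eq]
        simp only [zero_apply, sub_zero]
        abel
      rw [h2]
      exact hmv
    · intro t ht
      have h2 := hmain t ht
      have h3 := ((hasLogDerivAt_lieExp_neg_mul_lieExp_add (G := G) ξ ζ t).hasFDerivAt_unitChart
        h2.2.1).hasDerivAt
      have h4 := (hasDerivAt_smul_expDiv (ad G (-ξ)) t).clm_apply (hasDerivAt_const t ζ)
      rw [← ad_smul, ← Ad_lieExp] at h4
      refine HasDerivAt.hasDerivWithinAt ((h3.sub h4).congr_deriv ?_)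
      simp [hφ]
    · intro t ht
      have h2 := hmain t ht
      have hb : φ (lieExp 𝓘(ℝ, E) G (t • (-ξ)) * lieExp 𝓘(ℝ, E) G (t • (ξ + ζ))) ∈
          Metric.closedBall e r := by
        rw [mem_closedBall_iff_norm]
        refine h2.2.2.trans (le_trans ?_ hζ.le)
        exact mul_le_of_le_one_right (by positivity) ht.2
      have h3 := (hrb hb).1.1
      rw [chartRight_unitCoord] at h3
      have h4 : ‖φ (lieExp 𝓘(ℝ, E) G (t • (-ξ)) * lieExp 𝓘(ℝ, E) G (t • (ξ + ζ))) - e‖ ≤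
          2 * K * ‖ζ‖ :=
        h2.2.2.trans (mul_le_of_le_one_right (by positivity) ht.2)
      have h5 := hnorm t ht
      calc ‖_‖ = ‖(chartRight E G (φ (lieExp 𝓘(ℝ, E) G (t • (-ξ)) *
            lieExp 𝓘(ℝ, E) G (t • (ξ + ζ)))) - ContinuousLinearMap.id ℝ E)
              (Ad (lieExp 𝓘(ℝ, E) G (t • (-ξ))) ζ)‖ := by simp
        _ ≤ (L * (2 * K * ‖ζ‖)) * (K * ‖ζ‖) := by
            refine (ContinuousLinearMap.le_opNorm _ _).trans ?_
            refine mul_le_mul (h3.trans ?_) h5 (norm_nonneg _) (by positivity)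
            exact mul_le_mul_of_nonneg_left h4 hL0.le
        _ = _ := by ring
  have htend : Tendsto (fun ζ => φ (k ζ)) (𝓝 0) (𝓝 e) := by
    rw [tendsto_iff_norm_sub_tendsto_zero]
    refine squeeze_zero' (g := fun ζ => 2 * K * ‖ζ‖) (Eventually.of_forall fun _ => norm_nonneg _)
      (hsmall.mono fun ζ hζ => (hbound ζ hζ).2.1) ?_
    have h1 : Tendsto (fun ζ : E => 2 * K * ‖ζ‖) (𝓝 0) (𝓝 (2 * K * ‖(0 : E)‖)) :=
      (continuous_const.mul continuous_norm).tendsto 0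
    simpa using h1
  refine ⟨?_, ?_⟩
  · have h1 : Tendsto (fun ζ => φ.symm (φ (k ζ))) (𝓝 0) (𝓝 1) :=
      (tendsto_unitChart_symm (E := E) (G := G)).comp htend
    change Tendsto k (𝓝 0) (𝓝 (k 0))
    rw [hk0]
    exact h1.congr' (hsmall.mono fun ζ hζ => φ.left_inv (hbound ζ hζ).1)
  · change HasFDerivAt (fun ζ => φ (k ζ * (k 0)⁻¹)) _ 0
    simp only [hk0, inv_one, mul_one]
    rw [hasFDerivAt_iff_isLittleO_nhds_zero]
    refine Asymptotics.IsBigO.trans_isLittleO (g := fun ζ : E => ‖ζ‖ ^ 2) ?_ ?_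
    · refine Asymptotics.IsBigO.of_bound (2 * L * K * K) (hsmall.mono fun ζ hζ => ?_)
      have h1 := (hbound ζ hζ).2.2
      rw [zero_add, hk0, Real.norm_of_nonneg (by positivity)]
      exact h1
    · exact (Asymptotics.isLittleO_norm_pow_id one_lt_two)

variable (G) in
/-- The right logarithmic derivative of the exponential map at `ξ` is `dexp_ξ`. -/
theorem hasLogDerivAt_lieExp (ξ : E) :
    HasLogDerivAt (fun ζ : E => lieExp 𝓘(ℝ, E) G ζ) (dexp G ξ) ξ := by
  have h1 : HasLogDerivAt (fun ζ : E => lieExp 𝓘(ℝ, E) G (-ξ) * lieExp 𝓘(ℝ, E) G (ξ + (ζ - ξ)))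
      ((dexp G (-ξ)).comp (ContinuousLinearMap.id ℝ E)) ξ :=
    HasLogDerivAt.comp (f := fun ζ => ζ - ξ)
      (g := fun ζ : E => lieExp 𝓘(ℝ, E) G (-ξ) * lieExp 𝓘(ℝ, E) G (ξ + ζ))
      (by simpa using hasLogDerivAt_lieExp_neg_mul (G := G) ξ)
      ((hasFDerivAt_id ξ).sub_const ξ)
  have h2 := h1.const_mul (lieExp 𝓘(ℝ, E) G ξ)
  rw [ContinuousLinearMap.comp_id, ← dexp_eq_Ad_comp] at h2
  simpa [lieExp_neg] using h2

theorem HasFDerivAt.lieExp {M : Type*} [NormedAddCommGroup M] [NormedSpace ℝ M] {X : M → E}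
    {X' : M →L[ℝ] E} {y : M} (h : HasFDerivAt X X' y) :
    HasLogDerivAt (fun z => lieExp 𝓘(ℝ, E) G (X z)) ((dexp G (X y)).comp X') y :=
  HasLogDerivAt.comp (hasLogDerivAt_lieExp G (X y)) h

variable (G) in
theorem contMDiff_lieExp : ContMDiff 𝓘(ℝ, E) 𝓘(ℝ, E) 1 (fun ξ : E => lieExp 𝓘(ℝ, E) G ξ) :=
  fun _ => contMDiffAt_of_hasLogDerivAt (hasLogDerivAt_lieExp G)
    (contDiff_dexp (n := 0) G).continuous

end ExpDeriv

/-! ### Calculus on the group `G ⋉ 𝔤*` -/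

section CotangentCalculus

theorem cotangent_ext {E : Type*} [NormedAddCommGroup E] [NormedSpace ℝ E] {G : Type*}
    {x y : Cotangent E G} (h1 : x.base = y.base) (h2 : x.momentum = y.momentum) : x = y :=
  Prod.ext h1 h2

variable {E : Type*} [NormedAddCommGroup E] [NormedSpace ℝ E]
variable {G : Type*} [TopologicalSpace G] [ChartedSpace E G]
variable {M : Type*} [NormedAddCommGroup M] [NormedSpace ℝ M]

theorem contMDiff_base {n : WithTop ℕ∞} :
    ContMDiff (cotModel E) 𝓘(ℝ, E) n (Cotangent.base : Cotangent E G → G) :=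
  contMDiff_fst (M := G) (N := E →L[ℝ] ℝ)

theorem contMDiff_momentum {n : WithTop ℕ∞} :
    ContMDiff (cotModel E) 𝓘(ℝ, E →L[ℝ] ℝ) n
      (Cotangent.momentum : Cotangent E G → E →L[ℝ] ℝ) :=
  contMDiff_snd (M := G) (N := E →L[ℝ] ℝ)

theorem hasMFDerivAt_base (x : Cotangent E G) :
    HasMFDerivAt (cotModel E) 𝓘(ℝ, E) (Cotangent.base : Cotangent E G → G) x
      (ContinuousLinearMap.fst ℝ E (E →L[ℝ] ℝ)) :=
  hasMFDerivAt_fst (M := G) (M' := E →L[ℝ] ℝ) (I := 𝓘(ℝ, E)) (I' := 𝓘(ℝ, E →L[ℝ] ℝ)) (x := x)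

theorem hasMFDerivAt_momentum (x : Cotangent E G) :
    HasMFDerivAt (cotModel E) 𝓘(ℝ, E →L[ℝ] ℝ)
      (Cotangent.momentum : Cotangent E G → E →L[ℝ] ℝ) x
      (ContinuousLinearMap.snd ℝ E (E →L[ℝ] ℝ)) :=
  hasMFDerivAt_snd (M := G) (M' := E →L[ℝ] ℝ) (I := 𝓘(ℝ, E)) (I' := 𝓘(ℝ, E →L[ℝ] ℝ)) (x := x)

theorem HasMFDerivAt.base {Ψ : M → Cotangent E G} {y : M} {D : M →L[ℝ] E × (E →L[ℝ] ℝ)}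
    (h : HasMFDerivAt 𝓘(ℝ, M) (cotModel E) Ψ y D) :
    HasMFDerivAt 𝓘(ℝ, M) 𝓘(ℝ, E) (fun z => (Ψ z).base) y
      ((ContinuousLinearMap.fst ℝ E (E →L[ℝ] ℝ)).comp D) :=
  HasMFDerivAt.comp y (hasMFDerivAt_base (Ψ y)) h

theorem HasMFDerivAt.momentum {Ψ : M → Cotangent E G} {y : M} {D : M →L[ℝ] E × (E →L[ℝ] ℝ)}
    (h : HasMFDerivAt 𝓘(ℝ, M) (cotModel E) Ψ y D) :
    HasFDerivAt (fun z => (Ψ z).momentum) ((ContinuousLinearMap.snd ℝ E (E →L[ℝ] ℝ)).comp D) y :=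
  hasMFDerivAt_iff_hasFDerivAt.1 (HasMFDerivAt.comp y (hasMFDerivAt_momentum (Ψ y)) h)

theorem HasMFDerivAt.cotangentMk {g : M → G} {ν : M → E →L[ℝ] ℝ} {y : M} {D : M →L[ℝ] E}
    {D' : M →L[ℝ] E →L[ℝ] ℝ} (hg : HasMFDerivAt 𝓘(ℝ, M) 𝓘(ℝ, E) g y D) (hν : HasFDerivAt ν D' y) :
    HasMFDerivAt 𝓘(ℝ, M) (cotModel E) (fun z => Cotangent.mk (g z) (ν z)) y
      (D.prod D' : M →L[ℝ] E × (E →L[ℝ] ℝ)) :=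
  HasMFDerivAt.prodMk hg hν.hasMFDerivAt

variable [Group G]

theorem momentum_mul (x y : Cotangent E G) :
    (x * y).momentum = x.momentum + y.momentum.comp (Ad x.base⁻¹) := rfl

/-- At the identity, the derivative of a map from `G` to a vector space can be computed in the
chart. -/
theorem hasMFDerivAt_one_of_symm {f : G → M} {D : E →L[ℝ] M}
    (h : HasFDerivAt (fun b => f ((unitChart E G).symm b)) D (unitCoord E G)) :
    HasMFDerivAt 𝓘(ℝ, E) 𝓘(ℝ, M) f 1 D := by
  refine ⟨?_, ?_⟩
  · refine (ContinuousAt.comp (f := unitChart E G) (x := (1 : G)) h.continuousAt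
      continuousAt_unitChart).congr_of_eventuallyEq ?_
    filter_upwards [eventually_unitChart_left_inv (E := E) (G := G)] with g hg
    simp only [comp_apply, hg]
  · change HasFDerivWithinAt (fun b => f ((unitChart E G).symm b)) D (Set.range id) (unitCoord E G)
    exact h.hasFDerivWithinAt

variable [LieGroup 𝓘(ℝ, E) ∞ G]

theorem IsOneParameterSubgroup.base {γ : ℝ → Cotangent E G} {Y : E} {η : E →L[ℝ] ℝ}
    (h : IsOneParameterSubgroup (cotModel E) γ ((Y, η) : E × (E →L[ℝ] ℝ))) :
    IsOneParameterSubgroup 𝓘(ℝ, E) (fun t => (γ t).base) Y := by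
  refine ⟨fun s t => congrArg Cotangent.base (h.1 s t), contMDiff_base.comp h.2.1, ?_⟩
  have h1 := (HasMFDerivAt.base h.hasMFDerivAt_zero).mfderiv
  have h2 : (show ℝ →L[ℝ] E from mfderiv 𝓘(ℝ, ℝ) 𝓘(ℝ, E) (fun t => (γ t).base) 0) = _ := h1
  exact (DFunLike.congr_fun h2 (1 : ℝ)).trans (one_smul ℝ Y)

theorem Ad_inv (g : G) : Ad (E := E) g⁻¹ = Ring.inverse (Ad (E := E) g) := by
  have h1 : Ad (E := E) g * Ad (E := E) g⁻¹ = 1 := by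
    have := (Ad_mul (E := E) g g⁻¹).symm
    rw [mul_inv_cancel, Ad_one] at this
    exact this
  have h2 : Ad (E := E) g⁻¹ * Ad (E := E) g = 1 := by
    have := (Ad_mul (E := E) g⁻¹ g).symm
    rw [inv_mul_cancel, Ad_one] at this
    exact this
  exact (Ring.inverse_unit (⟨_, _, h1, h2⟩ : (E →L[ℝ] E)ˣ)).symm

variable [FiniteDimensional ℝ E]

theorem hasMFDerivAt_Ad_inv :
    HasMFDerivAt 𝓘(ℝ, E) 𝓘(ℝ, E →L[ℝ] E) (fun g : G => Ad (E := E) g⁻¹) 1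
      (-adCLM G : E →L[ℝ] E →L[ℝ] E) := by
  refine hasMFDerivAt_one_of_symm ?_
  simp only [Ad_inv]
  have h1 : chartAd E G (unitCoord E G) = ((1 : (E →L[ℝ] E)ˣ) : E →L[ℝ] E) := by
    simp only [chartAd, unitChart_symm_unitCoord, Ad_one]
    rfl
  have h2 := HasFDerivAt.comp (f := chartAd E G) (unitCoord E G)
    (by rw [h1]; exact hasFDerivAt_ringInverse (1 : (E →L[ℝ] E)ˣ)) (hasFDerivAt_chartAd G)
  refine h2.congr_fderiv ?_
  ext1 v
  have h3 := fderiv_chartAd_eq_ad G v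
  simp [h3, adCLM_apply]

/-- The components of `T_e R_x (ξ, n)`: the right trivialisation of the first one is `ξ`, and the
second one is `n - ad_ξ^* μ`, where `μ` is the momentum of `x`. -/
theorem rightMap_apply (x : Cotangent E G) (ξ : E) (n : E →L[ℝ] ℝ) :
    rightTriv x.base (show E × (E →L[ℝ] ℝ) from rightMap x (ξ, n)).1 = ξ ∧
      (show E × (E →L[ℝ] ℝ) from rightMap x (ξ, n)).2 = n - x.momentum.comp (ad G ξ) := by
  have h1 : HasMFDerivAt 𝓘(ℝ, E) 𝓘(ℝ, E) (fun y : G => y * x.base) 1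
      (rightTranslate (E := E) x.base) :=
    ((contMDiff_mul_right (I := 𝓘(ℝ, E)) (n := ∞)
      (a := x.base)).mdifferentiable (by simp) 1).hasMFDerivAt
  have h2 : HasMFDerivAt (cotModel E) 𝓘(ℝ, E) (fun y : Cotangent E G => y.base * x.base) 1
      ((show E →L[ℝ] E from rightTranslate x.base).comp
        (ContinuousLinearMap.fst ℝ E (E →L[ℝ] ℝ))) :=
    HasMFDerivAt.comp (g := fun y : G => y * x.base) (1 : Cotangent E G) h1 (hasMFDerivAt_base 1)
  have h3 : HasMFDerivAt (cotModel E) 𝓘(ℝ, E →L[ℝ] ℝ)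
      (fun y : Cotangent E G => x.momentum.comp (Ad (E := E) y.base⁻¹)) 1
      ((ContinuousLinearMap.compL ℝ E E ℝ x.momentum).comp
        ((-adCLM G : E →L[ℝ] E →L[ℝ] E).comp (ContinuousLinearMap.fst ℝ E (E →L[ℝ] ℝ)))) :=
    HasMFDerivAt.comp (1 : Cotangent E G)
      (ContinuousLinearMap.hasMFDerivAt (ContinuousLinearMap.compL ℝ E E ℝ x.momentum))
      (HasMFDerivAt.comp (g := fun g : G => Ad (E := E) g⁻¹) (1 : Cotangent E G)
        hasMFDerivAt_Ad_inv (hasMFDerivAt_base 1))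
  have h4 : HasMFDerivAt (cotModel E) 𝓘(ℝ, E →L[ℝ] ℝ)
      (fun y : Cotangent E G => y.momentum + x.momentum.comp (Ad (E := E) y.base⁻¹)) 1
      (ContinuousLinearMap.snd ℝ E (E →L[ℝ] ℝ) +
        (ContinuousLinearMap.compL ℝ E E ℝ x.momentum).comp
        ((-adCLM G : E →L[ℝ] E →L[ℝ] E).comp (ContinuousLinearMap.fst ℝ E (E →L[ℝ] ℝ)))) :=
    HasMFDerivAt.add (hasMFDerivAt_momentum 1) h3
  have h5 : (show E × (E →L[ℝ] ℝ) →L[ℝ] E × (E →L[ℝ] ℝ) from rightMap x) = _ :=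
    (HasMFDerivAt.prodMk h2 h4).mfderiv
  have h6 : (show E × (E →L[ℝ] ℝ) from rightMap x (ξ, n)) =
      ((show E →L[ℝ] E from rightTranslate x.base) ξ,
        n + x.momentum.comp (-ad G ξ)) := DFunLike.congr_fun h5 (ξ, n)
  rw [h6]
  constructor
  · have h7 := rightTriv_rightTranslate x.base ξ
    have h8 : (show E →L[ℝ] E from rightTriv (1 * x.base)) = rightTriv x.base := by
      rw [one_mul]
    exact (DFunLike.congr_fun h8 _).symm.trans h7
  · simp [sub_eq_add_neg]

variable [T2Space G]

/-- The momentum component of a one-parameter subgroup of `G ⋉ 𝔤*`: by the homomorphism property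
its derivative at `t` is `Ad_{exp (-t Y)}^* η`, and it vanishes at `0`. -/
theorem IsOneParameterSubgroup.momentum_eq {γ : ℝ → Cotangent E G} {Y : E} {η : E →L[ℝ] ℝ}
    (h : IsOneParameterSubgroup (cotModel E) γ ((Y, η) : E × (E →L[ℝ] ℝ))) (t : ℝ) :
    (γ t).momentum = η.comp (t • expDiv (t • ad G (-Y))) := by
  have hb : ∀ t, (γ t).base = lieExp 𝓘(ℝ, E) G (t • Y) := fun t =>
    congrFun (h.base.unique (isOneParameterSubgroup_lieExp G Y)) t
  have h0 : HasDerivAt (fun t => (γ t).momentum) η 0 := by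
    have := (HasMFDerivAt.momentum h.hasMFDerivAt_zero).hasDerivAt
    simpa using! this
  have hd : ∀ s, HasDerivAt (fun t => (γ t).momentum)
      (η.comp (NormedSpace.exp (s • ad G (-Y)))) s := by
    intro s
    have h1 : HasDerivAt (fun t : ℝ => t - s) 1 s := (hasDerivAt_id s).sub_const s
    have h2 := HasDerivAt.scomp s (h := fun t : ℝ => t - s) (by simpa using h0) h1
    rw [one_smul] at h2
    have h3 := (h2.clm_comp (hasDerivAt_const s (NormedSpace.exp (s • ad G (-Y))))).const_add
      (γ s).momentum
    refine (h3.congr_deriv (by simp)).congr_of_eventuallyEq (Eventually.of_forall fun t => ?_)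
    have h4 : γ t = γ s * γ (t - s) := by rw [← h.1, add_sub_cancel]
    simp only [comp_apply]
    conv_lhs => rw [h4]
    rw [momentum_mul, hb, ← lieExp_neg, Ad_lieExp, ← ad_smul, smul_neg]
  have hF : ∀ s, HasDerivAt
      (fun t => (γ t).momentum - η.comp (t • expDiv (t • ad G (-Y)))) 0 s := by
    intro s
    refine ((hd s).sub (((hasDerivAt_const s η)).clm_comp
      (hasDerivAt_smul_expDiv (ad G (-Y)) s))).congr_deriv ?_
    simp
  have h6 := is_const_of_deriv_eq_zero (fun t => (hF t).differentiableAt)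
    (fun t => (hF t).deriv) t 0
  have h7 : (γ 0).momentum = 0 := by rw [h.map_zero]; rfl
  rw [h7, zero_smul, ContinuousLinearMap.comp_zero, sub_zero, sub_eq_zero] at h6
  exact h6

/-- The one-parameter subgroups of `G ⋉ 𝔤*`. The momentum component satisfies a cocycle identity
(`hFadd` below), which holds since both sides are primitives of the same function. -/
theorem isOneParameterSubgroup_cotangent (Y : E) (η : E →L[ℝ] ℝ) :
    IsOneParameterSubgroup (cotModel E)
      (fun t : ℝ => (Cotangent.mk (lieExp 𝓘(ℝ, E) G (t • Y))
        (η.comp (t • expDiv (t • ad G (-Y)))) : Cotangent E G)) ((Y, η) : E × (E →L[ℝ] ℝ)) := by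
  have hexp := isOneParameterSubgroup_lieExp G Y
  set F : ℝ → E →L[ℝ] E := fun t => t • expDiv (t • ad G (-Y)) with hF
  have hFadd : ∀ s t, F (s + t) = F s + F t * NormedSpace.exp (s • ad G (-Y)) := by
    intro s t
    have hd : ∀ t, HasDerivAt (fun t => F (s + t) -
        (F s + F t * NormedSpace.exp (s • ad G (-Y)))) 0 t := by
      intro t
      have h1 := HasDerivAt.scomp t (hasDerivAt_smul_expDiv (ad G (-Y)) (s + t))
        ((hasDerivAt_id t).const_add s)
      refine (h1.sub (((hasDerivAt_smul_expDiv (ad G (-Y)) t).mul_const _).const_add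
        (F s))).congr_deriv ?_
      rw [exp_smul_mul_exp_smul, add_comm t s, one_smul, sub_self]
    have h6 := is_const_of_deriv_eq_zero (fun t => (hd t).differentiableAt)
      (fun t => (hd t).deriv) t 0
    simp only [add_zero] at h6
    rw [show F 0 = 0 by simp [hF], zero_mul, add_zero, sub_self, sub_eq_zero] at h6
    exact h6
  refine ⟨fun s t => cotangent_ext (hexp.1 s t) ?_, ?_, ?_⟩
  · rw [momentum_mul]
    change η.comp (F (s + t)) = η.comp (F s) +
      (η.comp (F t)).comp (Ad (lieExp 𝓘(ℝ, E) G (s • Y))⁻¹)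
    rw [← lieExp_neg, Ad_lieExp, ← smul_neg, ad_smul, hFadd, ContinuousLinearMap.comp_add]
    rfl
  · refine ContMDiff.prodMk hexp.2.1 (ContDiff.contMDiff ?_)
    refine contDiff_const.clm_comp (contDiff_id.smul (contDiff_expDiv.comp ?_))
    exact contDiff_id.smul contDiff_const
  · have h1 : HasFDerivAt (fun t => η.comp (F t)) ((1 : ℝ →L[ℝ] ℝ).smulRight η) 0 := by
      have h2 := (hasDerivAt_const (0 : ℝ) η).clm_comp (hasDerivAt_smul_expDiv (ad G (-Y)) 0)
      refine (h2.congr_deriv (g' := η) ?_).hasFDerivAt.congr_fderiv (by ext; simp)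
      simp only [zero_smul, NormedSpace.exp_zero, ContinuousLinearMap.zero_comp, zero_add]
      rfl
    have h3 := (HasMFDerivAt.cotangentMk hexp.hasMFDerivAt_zero h1).mfderiv
    have h4 : (show ℝ →L[ℝ] E × (E →L[ℝ] ℝ) from mfderiv 𝓘(ℝ, ℝ) (cotModel E)
      (fun t : ℝ => (Cotangent.mk (lieExp 𝓘(ℝ, E) G (t • Y)) (η.comp (F t)) : Cotangent E G)) 0)
        = _ := h3
    have h5 := DFunLike.congr_fun h4 (1 : ℝ)
    simpa using! h5

/-- The exponential map of `G ⋉ 𝔤*`. -/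
theorem lieExp_cotangent (Y : E) (η : E →L[ℝ] ℝ) :
    lieExp (cotModel E) (Cotangent E G) ((Y, η) : E × (E →L[ℝ] ℝ)) =
      Cotangent.mk (lieExp 𝓘(ℝ, E) G Y) (η.comp (dexp G (-Y))) := by
  have h : ∃ γ : ℝ → Cotangent E G,
      IsOneParameterSubgroup (cotModel E) γ ((Y, η) : E × (E →L[ℝ] ℝ)) :=
    ⟨_, isOneParameterSubgroup_cotangent Y η⟩
  rw [lieExp, dif_pos h]
  refine cotangent_ext ?_ ?_
  · have := congrFun (h.choose_spec.base.unique (isOneParameterSubgroup_lieExp G Y)) 1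
    simpa using! this
  · have := h.choose_spec.momentum_eq 1
    simpa using! this

variable {s : ℕ}

/-- The update of the scheme: `(exp Y · g₀, Ad_{exp (-Y)}^* (μ₀ + ∑ᵢ bᵢ nᵢ))`. -/
theorem update_eq (a : Fin s → Fin s → ℝ) (b : Fin s → ℝ) (x : Cotangent E G)
    (k : Fin s → E × (E →L[ℝ] ℝ)) (hinv : (dexp G (stageY b k)).IsInvertible) :
    update a b x k = Cotangent.mk (lieExp 𝓘(ℝ, E) G (stageY b k) * x.base)
      ((x.momentum + ∑ i, b i • stageN G a k i).comp
        (Ad (lieExp 𝓘(ℝ, E) G (-stageY b k)))) := by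
  rw [update, lieExp_cotangent]
  refine cotangent_ext rfl ?_
  rw [momentum_mul]
  change (dexpInvDual G (stageY b k) (∑ i, b i • stageN G a k i)).comp (dexp G (-stageY b k)) +
    x.momentum.comp (Ad (lieExp 𝓘(ℝ, E) G (stageY b k))⁻¹) =
    (x.momentum + ∑ i, b i • stageN G a k i).comp (Ad (lieExp 𝓘(ℝ, E) G (-stageY b k)))
  rw [← lieExp_neg, dexp_neg_eq_comp_Ad, dexpInvDual, ContinuousLinearMap.comp_assoc,
    ← ContinuousLinearMap.comp_assoc (dexp G (stageY b k)).inverse, hinv.inverse_comp_self,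
    ContinuousLinearMap.id_comp, ContinuousLinearMap.add_comp, add_comm]

end CotangentCalculus

/-! ### Exterior derivatives of the canonical one-form along `C¹` maps -/

section Closedness

variable {E : Type*} [NormedAddCommGroup E] [NormedSpace ℝ E]
variable {M : Type*} [NormedAddCommGroup M] [NormedSpace ℝ M]

/-- A product of a differentiable factor vanishing at `x` with a factor which is merely continuous
at `x` is differentiable at `x`. -/
theorem hasFDerivAt_comp_of_eq_zero {K : M → E →L[ℝ] ℝ} {K' : M →L[ℝ] E →L[ℝ] ℝ}
    {ρ : M → M →L[ℝ] E} {x : M} (hK : HasFDerivAt K K' x) (hK0 : K x = 0)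
    (hρ : ContinuousAt ρ x) :
    HasFDerivAt (fun y => (K y).comp (ρ y))
      (((ContinuousLinearMap.compL ℝ M E ℝ).flip (ρ x)).comp K') x := by
  have h1 : HasFDerivAt (fun y => (K y).comp (ρ x))
      (((ContinuousLinearMap.compL ℝ M E ℝ).flip (ρ x)).comp K') x :=
    ((ContinuousLinearMap.compL ℝ M E ℝ).flip (ρ x)).hasFDerivAt.comp x hK
  have h2 : HasFDerivAt (fun y => (K y).comp (ρ y - ρ x)) (0 : M →L[ℝ] M →L[ℝ] ℝ) x := by
    refine HasFDerivAt.of_isLittleO ?_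
    have h3 : (fun y => K y) =O[𝓝 x] fun y => y - x := by
      simpa [hK0] using hK.isBigO_sub
    have h4 : (fun y => ρ y - ρ x) =o[𝓝 x] fun _ => (1 : ℝ) := by
      rw [Asymptotics.isLittleO_one_iff]
      simpa using hρ.tendsto.sub_const (ρ x)
    have h5 := h3.norm_norm.mul_isLittleO h4.norm_left
    simp only [mul_one] at h5
    refine Asymptotics.IsBigO.trans_isLittleO (Asymptotics.IsBigO.of_bound 1
      (Eventually.of_forall fun y => ?_)) (Asymptotics.isLittleO_norm_right.1 h5)
    simp only [sub_self, ContinuousLinearMap.comp_zero, sub_zero, zero_apply, one_mul,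
      norm_mul, norm_norm]
    exact ContinuousLinearMap.opNorm_comp_le _ _
  refine (h1.add h2).congr_of_eventuallyEq (Eventually.of_forall fun y => ?_) |>.congr_fderiv
    (add_zero _)
  simp

variable {G : Type*} [TopologicalSpace G] [ChartedSpace E G] [Group G]
variable [LieGroup 𝓘(ℝ, E) ∞ G]

/-- Near `x`, the one-form `⟨c, dg g⁻¹⟩` is the sum of an exact form `dq` and of a form which is
differentiable at `x` although `dg g⁻¹` need only be continuous there. The exterior derivative of
that form is what the Maurer–Cartan equation gives for `⟨c, dg g⁻¹⟩`. -/
theorem exists_hasFDerivAt_comp_logDeriv_sub {g : M → G} {ρ : M → M →L[ℝ] E}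
    {c : M → E →L[ℝ] ℝ} {c' : M →L[ℝ] E →L[ℝ] ℝ} {x : M}
    (hg : ∀ᶠ y in 𝓝 x, HasLogDerivAt g (ρ y) y) (hρ : ContinuousAt ρ x)
    (hc : HasFDerivAt c c' x) :
    ∃ (q : M → ℝ) (q' : M → M →L[ℝ] ℝ) (B : M →L[ℝ] M →L[ℝ] ℝ),
      (∀ᶠ y in 𝓝 x, HasFDerivAt q (q' y) y) ∧
      HasFDerivAt (fun y => (c y).comp (ρ y) - q' y) B x ∧
      ∀ v w, B v w - B w v = c' v (ρ x w) - c' w (ρ x v) +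
        c x (bracket G (ρ x v) (ρ x w)) := by
  have hx := hg.self_of_nhds
  have hev : ∀ᶠ y in 𝓝 x, HasFDerivAt (fun z => unitChart E G (g z * (g x)⁻¹))
      ((chartRight E G (unitChart E G (g y * (g x)⁻¹))).comp (ρ y)) y := by
    filter_upwards [hg, hx.tendsto.eventually (unitDomain_mem_nhds (E := E) (G := G))] with y hy hy2
    exact (hy.mul_const (g x)⁻¹).hasFDerivAt_unitChart hy2
  -- `q` is `⟨c x, ·⟩` in the chart at the identity, translated to `g x`. Subtracting `dq` leaves
  -- `K ∘ ρ` with `K` differentiable and `K x = 0`.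
  set A := chartRight E G with hA
  have hA' : HasFDerivAt A (fderiv ℝ A (unitCoord E G)) (unitCoord E G) :=
    ((contDiffAt_chartRight (E := E) (G := G)).differentiableAt (by simp)).hasFDerivAt
  have hAq : HasFDerivAt (fun y => A (unitChart E G (g y * (g x)⁻¹)))
      ((fderiv ℝ A (unitCoord E G)).comp (ρ x)) x :=
    HasFDerivAt.comp (g := A) (f := fun y => unitChart E G (g y * (g x)⁻¹)) x
      (by simpa using hA') hx.2
  have hK : HasFDerivAt (fun y => c y - (c x).comp (A (unitChart E G (g y * (g x)⁻¹))))
      (c' - (ContinuousLinearMap.compL ℝ E E ℝ (c x)).comp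
        ((fderiv ℝ A (unitCoord E G)).comp (ρ x))) x :=
    hc.sub ((ContinuousLinearMap.compL ℝ E E ℝ (c x)).hasFDerivAt.comp x hAq)
  have hK0 : c x - (c x).comp (A (unitChart E G (g x * (g x)⁻¹))) = 0 := by
    rw [mul_inv_cancel, hA, chartRight_unitCoord, ContinuousLinearMap.comp_id, sub_self]
  refine ⟨fun y => c x (unitChart E G (g y * (g x)⁻¹)),
    fun y => (c x).comp ((A (unitChart E G (g y * (g x)⁻¹))).comp (ρ y)), _, ?_,
    (hasFDerivAt_comp_of_eq_zero hK hK0 hρ).congr_of_eventuallyEq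
      (Eventually.of_forall fun y => ?_), ?_⟩
  · filter_upwards [hev] with y hy
    exact (c x).hasFDerivAt.comp y hy
  · simp only [ContinuousLinearMap.sub_comp, ContinuousLinearMap.comp_assoc]
  · intro v w
    have h1 := fderiv_chartRight_apply (G := G) (ρ x v) (ρ x w)
    have h2 := fderiv_chartRight_apply (G := G) (ρ x w) (ρ x v)
    rw [bracket_eq, map_sub]
    simp [hA, h1, h2]
    ring

/-- If `⟨c₁, dg₁ g₁⁻¹⟩ - ⟨c₂, dg₂ g₂⁻¹⟩` is exact, then its exterior derivative vanishes, also when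
the maps `g₁`, `g₂` are only of class `C¹`. -/
theorem antisymm_eq_of_exact {g₁ g₂ : M → G} {ρ₁ ρ₂ : M → M →L[ℝ] E}
    {c₁ c₂ : M → E →L[ℝ] ℝ} {c₁' c₂' : M →L[ℝ] E →L[ℝ] ℝ} {S : M → ℝ} {x : M}
    (hg₁ : ∀ᶠ y in 𝓝 x, HasLogDerivAt g₁ (ρ₁ y) y) (hρ₁ : ContinuousAt ρ₁ x)
    (hc₁ : HasFDerivAt c₁ c₁' x)
    (hg₂ : ∀ᶠ y in 𝓝 x, HasLogDerivAt g₂ (ρ₂ y) y) (hρ₂ : ContinuousAt ρ₂ x)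
    (hc₂ : HasFDerivAt c₂ c₂' x)
    (hS : ∀ᶠ y in 𝓝 x, HasFDerivAt S ((c₁ y).comp (ρ₁ y) - (c₂ y).comp (ρ₂ y)) y) (v w : M) :
    c₁' v (ρ₁ x w) - c₁' w (ρ₁ x v) + c₁ x (bracket G (ρ₁ x v) (ρ₁ x w)) =
      c₂' v (ρ₂ x w) - c₂' w (ρ₂ x v) + c₂ x (bracket G (ρ₂ x v) (ρ₂ x w)) := by
  obtain ⟨q₁, q₁', B₁, hq₁, hB₁, hB₁'⟩ := exists_hasFDerivAt_comp_logDeriv_sub hg₁ hρ₁ hc₁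
  obtain ⟨q₂, q₂', B₂, hq₂, hB₂, hB₂'⟩ := exists_hasFDerivAt_comp_logDeriv_sub hg₂ hρ₂ hc₂
  have hf : ∀ᶠ y in 𝓝 x, HasFDerivAt (fun y => S y - q₁ y + q₂ y)
      (((c₁ y).comp (ρ₁ y) - q₁' y) - ((c₂ y).comp (ρ₂ y) - q₂' y)) y := by
    filter_upwards [hS, hq₁, hq₂] with y h1 h2 h3
    exact ((h1.sub h2).add h3).congr_fderiv (by abel)
  have hsymm := second_derivative_symmetric_of_eventually hf (hB₁.sub hB₂) v w
  simp only [sub_apply] at hsymm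
  rw [← hB₁', ← hB₂']
  linarith

/-- The symplectic form along a map into `G × 𝔤*` in terms of logarithmic derivatives. -/
theorem sympForm_apply {Ψ : M → Cotangent E G} {y : M} {D : M →L[ℝ] E × (E →L[ℝ] ℝ)}
    (hΨ : HasMFDerivAt 𝓘(ℝ, M) (cotModel E) Ψ y D) {ρ : M →L[ℝ] E} {μ' : M →L[ℝ] E →L[ℝ] ℝ}
    (hρ : HasLogDerivAt (fun z => (Ψ z).base) ρ y)
    (hμ : HasFDerivAt (fun z => (Ψ z).momentum) μ' y) (v w : M) :
    sympForm (Ψ y) (D v) (D w) =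
      μ' w (ρ v) - μ' v (ρ w) - (Ψ y).momentum (bracket G (ρ v) (ρ w)) := by
  have h1 := hρ.unique (HasMFDerivAt.hasLogDerivAt (HasMFDerivAt.base hΨ))
  have h2 := hμ.unique (HasMFDerivAt.momentum hΨ)
  subst h1 h2
  rfl

variable [FiniteDimensional ℝ E]

/-- The defining equation of the Hamiltonian vector field in the right trivialisation:
`dH (R_* η, δν) = ⟨δν, ξ⟩ - ⟨n, η⟩` where `f = (ξ, n)`. -/
theorem IsHamiltonianField.mfderiv_apply {H : Cotangent E G → ℝ}
    {f : Cotangent E G → E × (E →L[ℝ] ℝ)}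
    (hf : IsHamiltonianField H (fun x => rightMap x (f x))) (x : Cotangent E G)
    (X : E × (E →L[ℝ] ℝ)) :
    (show E × (E →L[ℝ] ℝ) →L[ℝ] ℝ from mfderiv (cotModel E) 𝓘(ℝ, ℝ) H x) X =
      X.2 (f x).1 - (f x).2 ((show E →L[ℝ] E from rightTriv x.base) X.1) := by
  have h1 := hf x X
  obtain ⟨h2, h3⟩ := rightMap_apply x (f x).1 (f x).2
  refine h1.symm.trans ?_
  change X.2 (rightTriv x.base (show E × (E →L[ℝ] ℝ) from rightMap x (f x)).1) -
    (show E × (E →L[ℝ] ℝ) from rightMap x (f x)).2 (rightTriv x.base X.1) -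
    x.momentum (bracket G (rightTriv x.base (show E × (E →L[ℝ] ℝ) from rightMap x (f x)).1)
      (rightTriv x.base X.1)) = _
  have h4 : rightMap x (f x) = rightMap x ((f x).1, (f x).2) := rfl
  rw [h4, h2, h3]
  have h5 : ∀ (u : ℝ) (n m : E →L[ℝ] ℝ) (A : E →L[ℝ] E) (η : E),
      u - (n - m.comp A) η - m (A η) = u - n η := by
    intro u n m A η
    rw [sub_apply, ContinuousLinearMap.comp_apply]
    ring
  exact h5 _ _ _ (ad G (f x).1) _

/-- The derivative of the Hamiltonian along a family of points of `G × 𝔤*`, in terms of the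
logarithmic derivative of the base points. -/
theorem IsHamiltonianField.hasFDerivAt_comp {H : Cotangent E G → ℝ}
    {f : Cotangent E G → E × (E →L[ℝ] ℝ)}
    (hf : IsHamiltonianField H (fun x => rightMap x (f x)))
    (hH : ContMDiff (cotModel E) 𝓘(ℝ, ℝ) ∞ H) {g : M → G} {ν : M → E →L[ℝ] ℝ}
    {σ : M →L[ℝ] E} {ν' : M →L[ℝ] E →L[ℝ] ℝ} {y : M}
    (hg : HasLogDerivAt g σ y) (hν : HasFDerivAt ν ν' y) :
    HasFDerivAt (fun z => H (Cotangent.mk (g z) (ν z)))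
      ((ContinuousLinearMap.apply ℝ ℝ (f (Cotangent.mk (g y) (ν y))).1).comp ν' -
        (f (Cotangent.mk (g y) (ν y))).2.comp σ) y := by
  have h1 := hg.mdifferentiableAt.hasMFDerivAt
  have h2 := hg.unique (HasMFDerivAt.hasLogDerivAt h1)
  have h3 : MDifferentiableAt (cotModel E) 𝓘(ℝ, ℝ) H (Cotangent.mk (g y) (ν y)) :=
    hH.mdifferentiable (by simp) _
  have h4 := hasMFDerivAt_iff_hasFDerivAt.1
    (HasMFDerivAt.comp y h3.hasMFDerivAt (HasMFDerivAt.cotangentMk h1 hν))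
  refine HasFDerivAt.congr_fderiv h4 ?_
  ext v
  refine (hf.mfderiv_apply (Cotangent.mk (g y) (ν y))
    ((show M →L[ℝ] E from mfderiv 𝓘(ℝ, M) 𝓘(ℝ, E) g y) v, ν' v)).trans ?_
  rw [h2]
  rfl

end Closedness

/-! ### Summation by parts over the stages -/

section StageAlgebra

variable {E : Type*} [AddCommGroup E] [Module ℝ E] {s : ℕ}

/-- The identity behind the choice of the stage momenta `M_i`, with `T = dexp_{-Y}` and
`T' i = dexp_{-X_i}`: interchanging the sums over `i` and `j`, the terms with `T' i` cancel. -/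
theorem stage_sum_eq (a : Fin s → Fin s → ℝ) {b : Fin s → ℝ} (hb : ∀ i, b i ≠ 0)
    (m : E →ₗ[ℝ] ℝ) (n : Fin s → E →ₗ[ℝ] ℝ) (T : E →ₗ[ℝ] E) (T' : Fin s → E →ₗ[ℝ] E)
    (ξ : Fin s → E) (r : E) :
    ∑ i, b i * ((m (T (ξ i)) + ∑ j, (b j * n j (T (ξ i)) - b j * a j i / b i * n j (T' j (ξ i)))) +
        n i (T' i (∑ j, a i j • ξ j) + r)) =
      (m (T (∑ i, b i • ξ i) + r) + ∑ j, b j * n j (T (∑ i, b i • ξ i) + r)) - m r := by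
  have h1 : ∑ i, b i * ∑ j, b j * a j i / b i * n j (T' j (ξ i)) =
      ∑ i, b i * n i (T' i (∑ j, a i j • ξ j)) := by
    simp only [Finset.mul_sum, map_sum, map_smul, smul_eq_mul]
    rw [Finset.sum_comm]
    refine Finset.sum_congr rfl fun i _ => Finset.sum_congr rfl fun j _ => ?_
    have := hb j
    field_simp
  have h2 : ∑ j, b j * n j (T (∑ i, b i • ξ i)) = ∑ i, b i * ∑ j, b j * n j (T (ξ i)) := by
    simp only [Finset.mul_sum, map_sum, map_smul, smul_eq_mul]
    rw [Finset.sum_comm]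
    refine Finset.sum_congr rfl fun i _ => Finset.sum_congr rfl fun j _ => ?_
    ring
  have h3 : m (T (∑ i, b i • ξ i)) = ∑ i, b i * m (T (ξ i)) := by
    simp only [map_sum, map_smul, smul_eq_mul]
  simp only [map_add, mul_add, Finset.sum_add_distrib, Finset.sum_sub_distrib, mul_sub]
  rw [h1, h2, h3]
  ring

end StageAlgebra

/-! ### Variation of the discrete action -/

section Stages

variable {E : Type*} [NormedAddCommGroup E] [NormedSpace ℝ E]
variable {M : Type*} [NormedAddCommGroup M] [NormedSpace ℝ M]
variable {s : ℕ} (a : Fin s → Fin s → ℝ) (b : Fin s → ℝ)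

theorem contDiff_stageY {n : WithTop ℕ∞} :
    ContDiff ℝ n (stageY b : (Fin s → E × (E →L[ℝ] ℝ)) → E) := by
  unfold stageY
  fun_prop

theorem contDiff_stageX (i : Fin s) {n : WithTop ℕ∞} :
    ContDiff ℝ n (fun k : Fin s → E × (E →L[ℝ] ℝ) => stageX a k i) := by
  unfold stageX
  fun_prop

theorem HasFDerivAt.fst_apply {K : M → Fin s → E × (E →L[ℝ] ℝ)}
    {K' : M →L[ℝ] Fin s → E × (E →L[ℝ] ℝ)} {y : M} (hK : HasFDerivAt K K' y) (i : Fin s) :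
    HasFDerivAt (fun z => (K z i).1) ((ContinuousLinearMap.fst ℝ E (E →L[ℝ] ℝ)).comp
      ((ContinuousLinearMap.proj i).comp K')) y :=
  (hasFDerivAt_pi'.1 hK i).fst

theorem HasFDerivAt.stageY {K : M → Fin s → E × (E →L[ℝ] ℝ)}
    {K' : M →L[ℝ] Fin s → E × (E →L[ℝ] ℝ)} {y : M} (hK : HasFDerivAt K K' y) :
    HasFDerivAt (fun z => stageY b (K z)) (∑ i, b i • (ContinuousLinearMap.fst ℝ E (E →L[ℝ] ℝ)).comp
      ((ContinuousLinearMap.proj i).comp K')) y :=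
  HasFDerivAt.fun_sum fun i _ => (HasFDerivAt.fst_apply hK i).const_smul (b i)

theorem HasFDerivAt.stageX {K : M → Fin s → E × (E →L[ℝ] ℝ)}
    {K' : M →L[ℝ] Fin s → E × (E →L[ℝ] ℝ)} {y : M} (hK : HasFDerivAt K K' y) (i : Fin s) :
    HasFDerivAt (fun z => stageX a (K z) i)
      (∑ j, a i j • (ContinuousLinearMap.fst ℝ E (E →L[ℝ] ℝ)).comp
        ((ContinuousLinearMap.proj j).comp K')) y :=
  HasFDerivAt.stageY (a i) hK

variable {G : Type*} [TopologicalSpace G] [T2Space G] [ChartedSpace E G] [Group G]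
  [LieGroup 𝓘(ℝ, E) ∞ G] [FiniteDimensional ℝ E]

variable (G) in
theorem contDiff_stageN (i : Fin s) {n : WithTop ℕ∞} :
    ContDiff ℝ n (fun k : Fin s → E × (E →L[ℝ] ℝ) => stageN G a k i) := by
  refine ContDiff.clm_comp (by fun_prop) ?_
  exact (contDiff_Ad_lieExp G).comp (contDiff_stageX a i)

variable (G) in
/-- The stage momenta are smooth in the stage values and the initial momentum; they do not depend on
the base point, which is taken to be `1`. -/
theorem contDiff_stageM (i : Fin s) {n : WithTop ℕ∞} :
    ContDiff ℝ n (fun p : (Fin s → E × (E →L[ℝ] ℝ)) × (E →L[ℝ] ℝ) =>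
      stageM a b (Cotangent.mk (1 : G) p.2) p.1 i) := by
  have hY : ContDiff ℝ n (fun p : (Fin s → E × (E →L[ℝ] ℝ)) × (E →L[ℝ] ℝ) =>
      dexp G (-stageY b p.1)) :=
    (contDiff_dexp G).comp ((contDiff_stageY b).comp contDiff_fst).neg
  have hX : ∀ j, ContDiff ℝ n (fun p : (Fin s → E × (E →L[ℝ] ℝ)) × (E →L[ℝ] ℝ) =>
      dexp G (-stageX a p.1 j)) := fun j =>
    (contDiff_dexp G).comp ((contDiff_stageX a j).comp contDiff_fst).neg
  have hN : ∀ j, ContDiff ℝ n (fun p : (Fin s → E × (E →L[ℝ] ℝ)) × (E →L[ℝ] ℝ) =>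
      stageN G a p.1 j) := fun j => (contDiff_stageN a G j).comp contDiff_fst
  refine ContDiff.add (contDiff_snd.clm_comp hY) (ContDiff.sum fun j _ => ContDiff.sub ?_ ?_)
  · exact ContDiff.const_smul _ ((hN j).clm_comp hY)
  · exact ContDiff.const_smul _ ((hN j).clm_comp (hX j))

variable (G) in
/-- The momentum after one step, as a function of the stage values `k` and the initial momentum
`μ`: it is `Ad_{exp (-Y)}^* (μ + ∑ᵢ bᵢ nᵢ)`. -/
def endMomentum (p : (Fin s → E × (E →L[ℝ] ℝ)) × (E →L[ℝ] ℝ)) : E →L[ℝ] ℝ :=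
  (p.2 + ∑ i, b i • stageN G a p.1 i).comp (Ad (lieExp 𝓘(ℝ, E) G (-stageY b p.1)))

variable (G) in
theorem contDiff_endMomentum {n : WithTop ℕ∞} :
    ContDiff ℝ n (endMomentum a b G : (Fin s → E × (E →L[ℝ] ℝ)) × (E →L[ℝ] ℝ) → E →L[ℝ] ℝ) := by
  refine ContDiff.clm_comp (contDiff_snd.add (ContDiff.sum fun j _ => ContDiff.const_smul _ ?_)) ?_
  · exact (contDiff_stageN a G j).comp contDiff_fst
  · exact (contDiff_Ad_lieExp G).comp ((contDiff_stageY b).comp contDiff_fst).neg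

variable {a b}

theorem Ad_lieExp_neg_apply (ξ η : E) :
    Ad (lieExp 𝓘(ℝ, E) G (-ξ)) (Ad (lieExp 𝓘(ℝ, E) G ξ) η) = η := by
  have h := Ad_mul (E := E) (lieExp 𝓘(ℝ, E) G (-ξ)) (lieExp 𝓘(ℝ, E) G ξ)
  rw [lieExp_neg, inv_mul_cancel, Ad_one, ← lieExp_neg] at h
  exact (DFunLike.congr_fun h η).symm

theorem Ad_lieExp_neg_dexp (ξ η : E) :
    Ad (lieExp 𝓘(ℝ, E) G (-ξ)) (dexp G ξ η) = dexp G (-ξ) η :=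
  (DFunLike.congr_fun (dexp_neg G ξ) η).symm

/-- The first variation of the discrete action `∑ᵢ bᵢ (⟨M_i, ξ_i⟩ - h H(G_i, M_i))`: it is the
difference `⟨μ₁, dg₁ g₁⁻¹⟩ - ⟨μ₀, dg₀ g₀⁻¹⟩` of the canonical one-forms at the two ends of the
step. -/
theorem hasFDerivAt_discreteAction (hb : ∀ i, b i ≠ 0) {H : Cotangent E G → ℝ}
    (hH : ContMDiff (cotModel E) 𝓘(ℝ, ℝ) ∞ H) {f : Cotangent E G → E × (E →L[ℝ] ℝ)}
    (hf : IsHamiltonianField H (fun x => rightMap x (f x))) {h : ℝ}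
    {g : M → G} {μ : M → E →L[ℝ] ℝ} {K : M → Fin s → E × (E →L[ℝ] ℝ)} {y : M} {ρ : M →L[ℝ] E}
    {K' : M →L[ℝ] Fin s → E × (E →L[ℝ] ℝ)}
    (hg : HasLogDerivAt g ρ y) (hμ : DifferentiableAt ℝ μ y) (hK : HasFDerivAt K K' y)
    (hsol : ∀ i, K y i = h • f (Cotangent.mk (stageG a (Cotangent.mk (g y) (μ y)) (K y) i)
      (stageM a b (Cotangent.mk (g y) (μ y)) (K y) i))) :
    HasFDerivAt (fun z => ∑ i, b i * (stageM a b (Cotangent.mk (g z) (μ z)) (K z) i (K z i).1 -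
        h * H (Cotangent.mk (stageG a (Cotangent.mk (g z) (μ z)) (K z) i)
          (stageM a b (Cotangent.mk (g z) (μ z)) (K z) i))))
      ((endMomentum a b G (K y, μ y)).comp ((dexp G (stageY b (K y))).comp
          (∑ i, b i • (ContinuousLinearMap.fst ℝ E (E →L[ℝ] ℝ)).comp
            ((ContinuousLinearMap.proj i).comp K')) +
          (Ad (lieExp 𝓘(ℝ, E) G (stageY b (K y)))).comp ρ) - (μ y).comp ρ) y := by
  -- The stage momentum depends on the initial value only through its momentum, so that
  -- `contDiff_stageM` applies although it is stated over the base point `1`.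
  have hM : ∀ i, ∃ M' : M →L[ℝ] E →L[ℝ] ℝ,
      HasFDerivAt (fun z => stageM a b (Cotangent.mk (g z) (μ z)) (K z) i) M' y := fun i =>
    ⟨_, (((contDiff_stageM a b G i (n := 1)).differentiable one_ne_zero (K y, μ y)).comp y
      (f := fun z => (K z, μ z)) (hK.differentiableAt.prodMk hμ)).hasFDerivAt⟩
  choose M' hM' using hM
  have hG := fun i => (HasFDerivAt.lieExp (G := G) (HasFDerivAt.stageX a hK i)).mul hg
  have hHi := fun i => hf.hasFDerivAt_comp hH (hG i) (hM' i)
  have hS := HasFDerivAt.fun_sum (u := Finset.univ) fun i _ =>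
    ((((hM' i).clm_apply (HasFDerivAt.fst_apply hK i)).sub ((hHi i).const_mul h)).const_mul (b i))
  refine hS.congr_fderiv ?_
  ext v
  have key := stage_sum_eq a hb (μ y).toLinearMap (fun i => (stageN G a (K y) i).toLinearMap)
    (dexp G (-stageY b (K y))).toLinearMap (fun i => (dexp G (-stageX a (K y) i)).toLinearMap)
    (fun i => (K' v i).1) (ρ v)
  -- `n̄_i = Ad_{exp (-X_i)}^* n_i`, and `Ad_{exp (-X_i)} dexp_{X_i} = dexp_{-X_i}`.
  have hL : ∀ i (η : E), (K y i).2 η = stageN G a (K y) i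
      (Ad (lieExp 𝓘(ℝ, E) G (-stageX a (K y) i)) η) := by
    intro i η
    have := Ad_lieExp_neg_apply (G := G) (-stageX a (K y) i) η
    rw [neg_neg] at this
    exact congrArg (K y i).2 this.symm
  have h1 : ∀ i, h * (f (Cotangent.mk (stageG a (Cotangent.mk (g y) (μ y)) (K y) i)
      (stageM a b (Cotangent.mk (g y) (μ y)) (K y) i))).2 (dexp G (stageX a (K y) i)
        (∑ j, a i j • (K' v j).1) + Ad (lieExp 𝓘(ℝ, E) G (stageX a (K y) i)) (ρ v)) =
      stageN G a (K y) i (dexp G (-stageX a (K y) i) (∑ j, a i j • (K' v j).1) + ρ v) := by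
    intro i
    have h2 := congrArg (fun q : E × (E →L[ℝ] ℝ) => q.2 (dexp G (stageX a (K y) i)
        (∑ j, a i j • (K' v j).1) + Ad (lieExp 𝓘(ℝ, E) G (stageX a (K y) i)) (ρ v))) (hsol i)
    refine h2.symm.trans ?_
    simp only [hL, map_add, Ad_lieExp_neg_apply, Ad_lieExp_neg_dexp]
  have h3 : ∀ (i) (ν : E →L[ℝ] ℝ), ν (K y i).1 =
      h * ν (f (Cotangent.mk (stageG a (Cotangent.mk (g y) (μ y)) (K y) i)
        (stageM a b (Cotangent.mk (g y) (μ y)) (K y) i))).1 := by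
    intro i ν
    have h2 := congrArg (fun q : E × (E →L[ℝ] ℝ) => ν q.1) (hsol i)
    simpa using! h2
  have h4 : ∀ i (η : E), stageM a b (Cotangent.mk (g y) (μ y)) (K y) i η =
      μ y (dexp G (-stageY b (K y)) η) + ∑ j,
        (b j * stageN G a (K y) j (dexp G (-stageY b (K y)) η) -
        b j * a j i / b i * stageN G a (K y) j (dexp G (-stageX a (K y) j) η)) := by
    intro i η
    simp [stageM, dexpDual, Cotangent.momentum, Cotangent.mk]
  -- The derivative of `M_i` drops out, because `ξ_i` is `h` times the derivative of `H` with
  -- respect to the momentum; the derivative with respect to the base point contributes `n̄_i`.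
  trans ∑ i, b i * (stageM a b (Cotangent.mk (g y) (μ y)) (K y) i (K' v i).1 +
    h * (f (Cotangent.mk (stageG a (Cotangent.mk (g y) (μ y)) (K y) i)
      (stageM a b (Cotangent.mk (g y) (μ y)) (K y) i))).2 (dexp G (stageX a (K y) i)
        (∑ j, a i j • (K' v j).1) + Ad (lieExp 𝓘(ℝ, E) G (stageX a (K y) i)) (ρ v)))
  · rw [sum_apply]
    refine Finset.sum_congr rfl fun i _ => ?_
    have h5 := h3 i (M' i v)
    have h6 : (∑ j, a i j • (ContinuousLinearMap.fst ℝ E (E →L[ℝ] ℝ)).comp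
        ((ContinuousLinearMap.proj j).comp K')) v = ∑ j, a i j • (K' v j).1 := by
      rw [sum_apply]
      rfl
    rw [← h6]
    refine congrArg (b i * ·) ?_
    change stageM a b (Cotangent.mk (g y) (μ y)) (K y) i (K' v i).1 + M' i v (K y i).1 -
      h * (M' i v (f (Cotangent.mk (stageG a (Cotangent.mk (g y) (μ y)) (K y) i)
        (stageM a b (Cotangent.mk (g y) (μ y)) (K y) i))).1 - _) = _
    rw [h5, mul_sub]
    have h7 : ∀ p q r : ℝ, p + q - (q - r) = p + r := fun p q r => by ring
    exact h7 _ _ _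
  · simp only [h1, h4]
    refine key.trans ?_
    have h6 : (∑ i, b i • (ContinuousLinearMap.fst ℝ E (E →L[ℝ] ℝ)).comp
        ((ContinuousLinearMap.proj i).comp K')) v = ∑ i, b i • (K' v i).1 := by
      rw [sum_apply]
      rfl
    have h7 : Ad (lieExp 𝓘(ℝ, E) G (-stageY b (K y))) (((dexp G (stageY b (K y))).comp
        (∑ i, b i • (ContinuousLinearMap.fst ℝ E (E →L[ℝ] ℝ)).comp
          ((ContinuousLinearMap.proj i).comp K')) +
        (Ad (lieExp 𝓘(ℝ, E) G (stageY b (K y)))).comp ρ) v) =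
        dexp G (-stageY b (K y)) (∑ i, b i • (K' v i).1) + ρ v := by
      rw [add_apply, ContinuousLinearMap.comp_apply, h6, ContinuousLinearMap.comp_apply, map_add,
        Ad_lieExp_neg_apply, Ad_lieExp_neg_dexp]
    rw [sub_apply, ContinuousLinearMap.comp_apply, endMomentum, ContinuousLinearMap.comp_apply, h7,
      add_apply, sum_apply]
    rfl

end Stages

/-! ### Symplecticity of the scheme -/

section Symplecticity

variable {E : Type*} [NormedAddCommGroup E] [NormedSpace ℝ E] [FiniteDimensional ℝ E]
variable {G : Type*} [TopologicalSpace G] [T2Space G] [ChartedSpace E G] [Group G]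
  [LieGroup 𝓘(ℝ, E) ∞ G]
variable {M : Type*} [NormedAddCommGroup M] [NormedSpace ℝ M]
variable {s : ℕ} {a : Fin s → Fin s → ℝ} {b : Fin s → ℝ}

theorem base_update (x : Cotangent E G) (k : Fin s → E × (E →L[ℝ] ℝ)) :
    (update a b x k).base = lieExp 𝓘(ℝ, E) G (stageY b k) * x.base := by
  rw [update, lieExp_cotangent]
  rfl

theorem momentum_update (x : Cotangent E G) {k : Fin s → E × (E →L[ℝ] ℝ)}
    (hinv : (dexp G (stageY b k)).IsInvertible) :
    (update a b x k).momentum = endMomentum a b G (k, x.momentum) := by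
  rw [update_eq a b x k hinv]
  rfl

/-- Along a family `P` of initial values and a `C¹` family `K` of stage values solving the stage
equations, the step of the scheme preserves the symplectic form. -/
theorem sympForm_update (hb : ∀ i, b i ≠ 0) {H : Cotangent E G → ℝ}
    (hH : ContMDiff (cotModel E) 𝓘(ℝ, ℝ) ∞ H) {f : Cotangent E G → E × (E →L[ℝ] ℝ)}
    (hf : IsHamiltonianField H (fun x => rightMap x (f x))) {h : ℝ}
    {P : M → Cotangent E G} {K : M → Fin s → E × (E →L[ℝ] ℝ)} {y : M} {ρ : M → M →L[ℝ] E}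
    (hρ : ∀ z, HasLogDerivAt (fun z => (P z).base) (ρ z) z) (hρc : Continuous ρ)
    (hμ : Differentiable ℝ fun z => (P z).momentum) (hK : ContDiffAt ℝ 1 K y)
    (hsol : ∀ᶠ z in 𝓝 y, IsStageSolution a b f h (P z) (K z))
    {D D₁ : M →L[ℝ] E × (E →L[ℝ] ℝ)} (hD : HasMFDerivAt 𝓘(ℝ, M) (cotModel E) P y D)
    (hD₁ : HasMFDerivAt 𝓘(ℝ, M) (cotModel E) (fun z => update a b (P z) (K z)) y D₁) (v w : M) :
    sympForm (update a b (P y) (K y)) (D₁ v) (D₁ w) = sympForm (P y) (D v) (D w) := by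
  have hKd : ∀ᶠ z in 𝓝 y, HasFDerivAt K (fderiv ℝ K z) z :=
    (hK.eventually (by simp)).mono fun z hz => (hz.differentiableAt one_ne_zero).hasFDerivAt
  have hKc : ContinuousAt (fderiv ℝ K) y := hK.continuousAt_fderiv one_ne_zero
  set ρ₁ : M → M →L[ℝ] E := fun z => (dexp G (stageY b (K z))).comp
    (∑ i, b i • (ContinuousLinearMap.fst ℝ E (E →L[ℝ] ℝ)).comp
      ((ContinuousLinearMap.proj i).comp (fderiv ℝ K z))) +
    (Ad (lieExp 𝓘(ℝ, E) G (stageY b (K z)))).comp (ρ z) with hρ₁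
  have hY : ContinuousAt (fun z => stageY b (K z)) y :=
    (contDiff_stageY b (n := 0)).continuous.continuousAt.comp hK.continuousAt
  have hρ₁c : ContinuousAt ρ₁ y := by
    refine ContinuousAt.add (ContinuousAt.clm_comp ?_ ?_)
      (ContinuousAt.clm_comp ?_ hρc.continuousAt)
    · exact (contDiff_dexp (n := 0) G).continuous.continuousAt.comp hY
    · refine tendsto_finsetSum _ fun i _ => ContinuousAt.const_smul ?_ (b i)
      exact continuousAt_const.clm_comp (continuousAt_const.clm_comp hKc)
    · exact (contDiff_Ad_lieExp (n := 0) G).continuous.continuousAt.comp hY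
  have hlog : ∀ᶠ z in 𝓝 y, HasLogDerivAt (fun z => (update a b (P z) (K z)).base) (ρ₁ z) z := by
    filter_upwards [hKd] with z hz
    simp only [base_update]
    exact (HasFDerivAt.lieExp (HasFDerivAt.stageY b hz)).mul (hρ z)
  have hend : DifferentiableAt ℝ (fun z => endMomentum a b G (K z, (P z).momentum)) y :=
    ((contDiff_endMomentum a b G (n := 1)).differentiable one_ne_zero (K y, (P y).momentum)).comp y
      (f := fun z => (K z, (P z).momentum)) ((hK.differentiableAt one_ne_zero).prodMk (hμ y))
  have hmom : HasFDerivAt (fun z => (update a b (P z) (K z)).momentum) _ y :=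
    hend.hasFDerivAt.congr_of_eventuallyEq
      (hsol.mono fun z hz => momentum_update (P z) hz.1)
  have hact : ∀ᶠ z in 𝓝 y, HasFDerivAt (fun z => ∑ i, b i *
      (stageM a b (P z) (K z) i (K z i).1 -
        h * H (Cotangent.mk (stageG a (P z) (K z) i) (stageM a b (P z) (K z) i))))
      (((update a b (P z) (K z)).momentum).comp (ρ₁ z) - ((P z).momentum).comp (ρ z)) z := by
    filter_upwards [hKd, hsol] with z hz hz2
    rw [momentum_update (P z) hz2.1]
    exact hasFDerivAt_discreteAction (μ := fun z => (P z).momentum) hb hH hf (hρ z) (hμ z) hz hz2.2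
  -- Apply `d` to `dS = ⟨μ₁, dg₁ g₁⁻¹⟩ - ⟨μ₀, dg₀ g₀⁻¹⟩`.
  have key := antisymm_eq_of_exact hlog hρ₁c hmom (Eventually.of_forall hρ) hρc.continuousAt
    (hμ y).hasFDerivAt hact v w
  rw [sympForm_apply hD₁ hlog.self_of_nhds hmom, sympForm_apply hD (hρ y) (hμ y).hasFDerivAt]
  linarith

/-- Exponential coordinates `(u, ν) ↦ (exp u · g, ν)` of `G × 𝔤*` near the points over `g`. In these
coordinates the scheme is differentiated on a vector space. -/
def expCoord (g : G) (p : E × (E →L[ℝ] ℝ)) : Cotangent E G :=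
  Cotangent.mk (lieExp 𝓘(ℝ, E) G p.1 * g) p.2

theorem hasLogDerivAt_expCoord (g : G) (p : E × (E →L[ℝ] ℝ)) :
    HasLogDerivAt (fun q => (expCoord g q).base)
      ((dexp G p.1).comp (ContinuousLinearMap.fst ℝ E (E →L[ℝ] ℝ))) p :=
  (HasFDerivAt.lieExp hasFDerivAt_fst).mul_const g

theorem contMDiff_expCoord (g : G) :
    ContMDiff 𝓘(ℝ, E × (E →L[ℝ] ℝ)) (cotModel E) 1 (expCoord (E := E) g) := by
  refine ContMDiff.prodMk ?_ (ContDiff.contMDiff contDiff_snd)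
  exact ((contMDiff_mul_right (I := 𝓘(ℝ, E)) (n := ∞) (a := g)).of_le (by simp)).comp
    ((contMDiff_lieExp G).comp (ContDiff.contMDiff contDiff_fst))

/-- `expCoord g` is a submersion at the points over `g`, where `dexp_0 = 1`. -/
theorem surjective_of_hasMFDerivAt_expCoord (g : G) (μ : E →L[ℝ] ℝ)
    {D : E × (E →L[ℝ] ℝ) →L[ℝ] E × (E →L[ℝ] ℝ)}
    (hD : HasMFDerivAt 𝓘(ℝ, E × (E →L[ℝ] ℝ)) (cotModel E) (expCoord g)
      ((0, μ) : E × (E →L[ℝ] ℝ)) D) :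
    Surjective D := by
  refine (LinearMap.injective_iff_surjective (f := D.toLinearMap)).1 ?_
  refine (injective_iff_map_eq_zero D.toLinearMap).2 fun q hq => ?_
  have h1 := (hasLogDerivAt_expCoord g ((0, μ) : E × (E →L[ℝ] ℝ))).unique
    (HasMFDerivAt.hasLogDerivAt (HasMFDerivAt.base hD))
  have h2 := (HasMFDerivAt.momentum hD).unique (hasFDerivAt_snd (p := ((0, μ) : E × (E →L[ℝ] ℝ))))
  have hq' : D q = 0 := hq
  have h3 : dexp G (0 : E) q.1 =
      (show E →L[ℝ] E from rightTriv (expCoord g ((0, μ) : E × (E →L[ℝ] ℝ))).base) (D q).1 :=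
    DFunLike.congr_fun h1 q
  have h4 : (D q).2 = q.2 := DFunLike.congr_fun h2 q
  rw [hq', dexp_zero] at h3
  rw [hq'] at h4
  exact Prod.ext (h3.trans (map_zero _)) h4.symm

/-- The update map of the scheme is of class `C¹` wherever the stage values are. -/
theorem contMDiffOn_update {f : Cotangent E G → E × (E →L[ℝ] ℝ)} {h : ℝ}
    {U : Set (Cotangent E G)} {k : Cotangent E G → Fin s → E × (E →L[ℝ] ℝ)}
    (hk : ContMDiffOn (cotModel E) 𝓘(ℝ, Fin s → E × (E →L[ℝ] ℝ)) 1 k U)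
    (hsol : ∀ x ∈ U, IsStageSolution a b f h x (k x)) :
    ContMDiffOn (cotModel E) (cotModel E) 1 (fun x => update a b x (k x)) U := by
  have : LieGroup 𝓘(ℝ, E) 1 G := LieGroup.of_le (n := ∞) (by simp)
  have h1 : ContMDiffOn (cotModel E) 𝓘(ℝ, E) 1
      (fun x : Cotangent E G => lieExp 𝓘(ℝ, E) G (stageY b (k x)) * x.base) U :=
    ContMDiffOn.mul (((contMDiff_lieExp G).comp
      (contDiff_stageY b).contMDiff).comp_contMDiffOn hk) contMDiff_base.contMDiffOn
  have h2 : ContMDiffOn (cotModel E) 𝓘(ℝ, E →L[ℝ] ℝ) 1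
      (fun x : Cotangent E G => endMomentum a b G (k x, x.momentum)) U :=
    ContMDiff.comp_contMDiffOn (contDiff_endMomentum a b G).contMDiff
      (ContMDiffOn.prodMk_space hk contMDiff_momentum.contMDiffOn)
  refine (ContMDiffOn.prodMk h1 h2).congr fun x hx => ?_
  exact cotangent_ext (base_update x (k x)) (momentum_update x (hsol x hx).1)

end Symplecticity

end SLGI

end

theorem mainTheorem2
    {E : Type*} [NormedAddCommGroup E] [NormedSpace ℝ E] [FiniteDimensional ℝ E]
    {G : Type*} [TopologicalSpace G] [T2Space G] [ChartedSpace E G] [Group G]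
    [LieGroup 𝓘(ℝ, E) ∞ G]
    {s : ℕ} (a : Fin s → Fin s → ℝ) (b : Fin s → ℝ)
    (hb_sum : ∑ i, b i = 1) (hb_ne : ∀ i, b i ≠ 0)
    (H : SLGI.Cotangent E G → ℝ) (hH : ContMDiff (SLGI.cotModel E) 𝓘(ℝ, ℝ) ∞ H)
    (f : SLGI.Cotangent E G → E × (E →L[ℝ] ℝ))
    (hf : SLGI.IsHamiltonianField H (fun x => SLGI.rightMap x (f x)))
    (h : ℝ) (U : Set (SLGI.Cotangent E G)) (hU : IsOpen U)
    (k : SLGI.Cotangent E G → Fin s → E × (E →L[ℝ] ℝ))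
    (hk : ContMDiffOn (SLGI.cotModel E) 𝓘(ℝ, Fin s → E × (E →L[ℝ] ℝ)) 1 k U)
    (hk_sol : ∀ x ∈ U, SLGI.IsStageSolution a b f h x (k x)) :
    SLGI.IsSymplecticOn (fun x => SLGI.update a b x (k x)) U := by
  have hΦ := SLGI.contMDiffOn_update hk hk_sol
  refine ⟨hΦ, fun x hx => ?_⟩
  -- Every tangent vector at `x` comes from the vector space of the coordinates `expCoord`, in which
  -- the scheme is differentiated.
  obtain ⟨g, μ, rfl⟩ : ∃ g μ, x = SLGI.expCoord g ((0, μ) : E × (E →L[ℝ] ℝ)) :=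
    ⟨x.base, x.momentum, SLGI.cotangent_ext (by
      change x.base = SLGI.lieExp 𝓘(ℝ, E) G 0 * x.base
      rw [SLGI.lieExp_zero, one_mul]) rfl⟩
  set P : E × (E →L[ℝ] ℝ) → SLGI.Cotangent E G := SLGI.expCoord g with hP
  set y : E × (E →L[ℝ] ℝ) := (0, μ)
  have hPc : ContMDiff 𝓘(ℝ, E × (E →L[ℝ] ℝ)) (SLGI.cotModel E) 1 P := SLGI.contMDiff_expCoord g
  have hUy : U ∈ nhds (P y) := hU.mem_nhds hx
  have hD := (hPc.mdifferentiable one_ne_zero y).hasMFDerivAt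
  have hΦy : MDifferentiableAt (SLGI.cotModel E) (SLGI.cotModel E)
      (fun x => SLGI.update a b x (k x)) (P y) :=
    (hΦ.contMDiffAt hUy).mdifferentiableAt one_ne_zero
  have hD₁ := HasMFDerivAt.comp y hΦy.hasMFDerivAt hD
  have hK : ContDiffAt ℝ 1 (fun z => k (P z)) y :=
    contMDiffAt_iff_contDiffAt.1 ((hk.contMDiffAt hUy).comp y hPc.contMDiffAt)
  have hsurj := SLGI.surjective_of_hasMFDerivAt_expCoord g μ hD
  intro V W
  obtain ⟨v, hv⟩ := hsurj V
  obtain ⟨w, hw⟩ := hsurj W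
  have hvw := SLGI.sympForm_update (M := E × (E →L[ℝ] ℝ)) hb_ne hH hf
    (SLGI.hasLogDerivAt_expCoord g) (((SLGI.contDiff_dexp (n := 0) G).continuous.comp
      continuous_fst).clm_comp continuous_const) differentiable_snd hK
    ((hPc.continuous.continuousAt.eventually hUy).mono fun z hz => hk_sol _ hz) hD hD₁ v w
  rw [← hv, ← hw]
  exact hvw
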